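/- Let $d_1,d_2\ge 1$ be integers and let $s>0$ be real. Let $B_1\subset\mathbb R^{d_1}$ be the open ball centred at $0$ with Lebesgue measure $|B_1|=1$, and let $H^1_0(B_1)$ be the closure of $C_c^\infty(B_1)$ in $H^1(B_1)$. For $\sigma>0$ let $E_1(\sigma,B_1)$ be the first (smallest) eigenvalue of the Schrödinger operator $-\Delta+\sigma|x|^{2s}$ in $B_1$ with Dirichlet boundary conditions, i.e. the smallest $\lambda\in\mathbb R$ for which there is $u\in H^1_0(B_1)$, $u\neq0$, with \[ \int_{B_1}\bigl(\nabla u\cdot\nabla v+\sigma|x|^{2s}uv\bigr)\,dx=\lambda\int_{B_1}uv\,dx\qquad\text{for all } v\in H^1_0(B_1); \] such a smallest $\lambda$ exists for every $\sigma>0$. Define \[ F(\sigma)=\sigma^{-\frac{d_2}{d_1+(1+s)d_2}}\,E_1(\sigma,B_1),\qquad \sigma\in(0,\infty). \] Then $F$ is smooth ($C^\infty$) on $(0,\infty)$; $F(\sigma)\to+\infty$ as $\sigma\to0^+$ and as $\sigma\to+\infty$; every critical point $\sigma>0$ of $F$ (that is, $F'(\sigma)=0$) satisfies $F''(\sigma)>0$;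 and $F$ has a unique minimum point in $(0,\infty)$, that is, there is exactly one $\sigma^*>0$ with $F(\sigma^*)\le F(\sigma)$ for all $\sigma>0$. -/

import Mathlib

open Set Filter Topology MeasureTheory
open scoped ContDiff

namespace Grushin

/-- The Euclidean space `ℝⁿ`. -/
abbrev Eu (n : ℕ) : Type := EuclideanSpace ℝ (Fin n)

/-- `φ ∈ C_c^∞(Ω)`: a smooth real function whose (closed) support is a compact subset of `Ω`. -/
def IsTestFunction {n : ℕ} (Ω : Set (Eu n)) (φ : Eu n → ℝ) : Prop :=
  ContDiff ℝ ∞ φ ∧ HasCompactSupport φ ∧ tsupport φ ⊆ Ω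

/-- `u ∈ H¹(Ω)` with weak gradient `g`: both are square integrable on `Ω`, and
`∫_Ω u ∇φ = - ∫_Ω φ g` (an identity in `ℝⁿ`) for all `φ ∈ C_c^∞(Ω)`. Functions are represented by
their values, and only their classes modulo null subsets of `Ω` matter. -/
def MemH1 {n : ℕ} (Ω : Set (Eu n)) (u : Eu n → ℝ) (g : Eu n → Eu n) : Prop :=
  MemLp u 2 (volume.restrict Ω) ∧ MemLp g 2 (volume.restrict Ω) ∧
    ∀ φ : Eu n → ℝ, IsTestFunction Ω φ →
      ∫ x in Ω, u x • gradient φ x = - ∫ x in Ω, φ x • g x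

/-- `u ∈ H¹₀(Ω)` with weak gradient `g`: `u` lies in the closure of `C_c^∞(Ω)` in `H¹(Ω)`, that is,
`φₖ → u` and `∇φₖ → g` in `L²(Ω)` for some sequence of test functions `φₖ`. -/
def MemH10 {n : ℕ} (Ω : Set (Eu n)) (u : Eu n → ℝ) (g : Eu n → Eu n) : Prop :=
  MemH1 Ω u g ∧ ∃ φ : ℕ → Eu n → ℝ, (∀ k, IsTestFunction Ω (φ k)) ∧
    Tendsto (fun k => eLpNorm (fun x => φ k x - u x) 2 (volume.restrict Ω)) atTop (𝓝 0) ∧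
    Tendsto (fun k => eLpNorm (fun x => gradient (φ k) x - g x) 2 (volume.restrict Ω))
      atTop (𝓝 0)

/-- `lam` is an eigenvalue of the Schrödinger operator `-Δ + μ |x|^{2s}` in (the bounded set) `Ω`
with Dirichlet boundary conditions, in the weak sense: for some `u ∈ H¹₀(Ω)`, `u ≠ 0`,
`∫_Ω ∇u · ∇v + μ |x|^{2s} u v = lam ∫_Ω u v` for all `v ∈ H¹₀(Ω)`. -/
def IsSchrodingerEigenvalue {n : ℕ} (s μ : ℝ) (Ω : Set (Eu n)) (lam : ℝ) : Prop :=
  ∃ (u : Eu n → ℝ) (gu : Eu n → Eu n), MemH10 Ω u gu ∧ ¬ (u =ᵐ[volume.restrict Ω] 0) ∧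
    ∀ (v : Eu n → ℝ) (gv : Eu n → Eu n), MemH10 Ω v gv →
      ∫ x in Ω, (inner ℝ (gu x) (gv x) + μ * ‖x‖ ^ (2 * s) * u x * v x)
        = lam * ∫ x in Ω, u x * v x

/-- The first eigenvalue `E₁(μ, Ω)` of `-Δ + μ |x|^{2s}` in `Ω` with Dirichlet boundary
conditions. -/
noncomputable def E1 {n : ℕ} (s μ : ℝ) (Ω : Set (Eu n)) : ℝ :=
  sInf {lam : ℝ | IsSchrodingerEigenvalue s μ Ω lam}

/-- The centred open ball of unit volume in `ℝⁿ` (for `n ≥ 1`); its radius is `τ^{-1/n}`, where `τ`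
is the volume of the ball of radius `1`. -/
noncomputable def unitVolumeBall (n : ℕ) : Set (Eu n) :=
  Metric.ball 0 ((volume (Metric.ball (0 : Eu n) 1)).toReal ^ (-(1 / (n : ℝ))))

theorem volume_unitVolumeBall {n : ℕ} (hn : 1 ≤ n) : volume (unitVolumeBall n) = 1 := by
  have hn' : (n : ℝ) ≠ 0 := by positivity
  have h0 : volume (Metric.ball (0 : Eu n) 1) ≠ 0 :=
    (Metric.measure_ball_pos volume _ one_pos).ne'
  have ht : volume (Metric.ball (0 : Eu n) 1) ≠ ⊤ := measure_ball_lt_top.ne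
  have hp : 0 < (volume (Metric.ball (0 : Eu n) 1)).toReal := ENNReal.toReal_pos h0 ht
  unfold unitVolumeBall
  rw [Measure.addHaar_ball_of_pos _ _ (Real.rpow_pos_of_pos hp _), finrank_euclideanSpace_fin,
    ← Real.rpow_mul_natCast hp.le]
  have : -(1 / (n : ℝ)) * n = -1 := by field_simp
  rw [this, Real.rpow_neg_one, ENNReal.ofReal_inv_of_pos hp, ENNReal.ofReal_toReal ht]
  exact ENNReal.inv_mul_cancel h0 ht

/-- The function `F(σ) = σ^{-d₂/(d₁+(1+s)d₂)} E₁(σ, B₁)`, `σ ∈ (0, ∞)`, where `B₁` is the centred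
ball of unit volume in `ℝ^{d₁}`. -/
noncomputable def F (d₁ d₂ : ℕ) (s : ℝ) (σ : ℝ) : ℝ :=
  σ ^ (-((d₂ : ℝ) / (d₁ + (1 + s) * d₂))) * E1 s σ (unitVolumeBall d₁)

end Grushin

/-! Put d₁ = n + 1 and let ρ be the radius of the ball. The problem is reduced to the radial
equation u'' + (n/r) u' = (σ r^{2s} - E) u on [0, ρ], solved from the centre with u(0) = 1. The
ground energy e(σ) is an E for which u is positive on [0, ρ) and has a simple zero at ρ
(`IsGround`). Radial symmetry of eigenfunctions is not assumed: `IsGround.isLeast` shows that e(σ)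
is the least weak Dirichlet eigenvalue, since the radial solution U is an eigenfunction and testing
its equation with φ²/U (Barta, Picone) excludes anything lower.

Now F = σ^{-α} e with 0 < α < 1/(1+s), and F' has the sign of p - α, where p = σ e'/e. Everything
rests on p' > 0 (`deriv_log_ground_pos`): at a critical point F'' has the sign of p', and p takes
the value α at most once. Smoothness of e comes from a Hellmann–Feynman formula and a bootstrap
(`contDiffOn_ground`). The limits of F come from a positive constant lower bound for e and one of
order σ^{1/(1+s)} (`IsGround.const_le_energy`, `IsGround.rpow_le_energy`).

For p' > 0, let v = ∂u/∂σ, X = u² rⁿ, and let M, N, L be the primitives of X, r^{2s} X, (r^{2s} -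
e') u v rⁿ. Up to a positive factor p' is the value at ρ of `variation`, a combination of M, N, L
that vanishes at 0, but whose integrand has no evident sign because of the product u v. The remedy
uses dilations: with R = σ e' M - σ N, the Pohozaev quantity S = 2eM - (2+2s)σN > 0, and q = R/S,
one adds boundary terms (`corrector`) that tend to 0 at both ends. The derivative of the sum is X (σ
r^{2s} (1 - (2+2s) q)² - e (p - 2q)²) + 2 r S q'², and the bracket is positive by the bounds on N/M
(`quad_pos`). Hence the sum increases strictly from 0 and is positive at ρ. -/

open scoped BoundedContinuousFunction

namespace Grushin

/-! ### Radial averages -/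

/-- The mean `∫₀¹ g(rτ) τⁿ dτ`, so that `r^{n+1}` times it is `∫₀^r g(t) tⁿ dt`. -/
noncomputable def radialAvg (n : ℕ) (g : ℝ → ℝ) (r : ℝ) : ℝ :=
  ∫ τ in (0 : ℝ)..1, g (r * τ) * τ ^ n

theorem continuous_radialAvg (n : ℕ) {g : ℝ → ℝ} (hg : Continuous g) :
    Continuous (radialAvg n g) := by
  refine intervalIntegral.continuous_parametric_intervalIntegral_of_continuous' ?_ 0 1
  fun_prop

theorem abs_radialAvg_le (n : ℕ) {g : ℝ → ℝ} {r C : ℝ} (hr : 0 ≤ r)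
    (hC : ∀ t ∈ Icc 0 r, |g t| ≤ C) : |radialAvg n g r| ≤ C := by
  have h := intervalIntegral.norm_integral_le_of_norm_le_const (a := (0 : ℝ)) (b := 1) (C := C)
    (f := fun τ => g (r * τ) * τ ^ n) ?_
  · simpa [radialAvg] using h
  · intro τ hτ
    rw [uIoc_of_le zero_le_one] at hτ
    have h1 : |g (r * τ)| ≤ C :=
      hC _ ⟨mul_nonneg hr hτ.1.le, mul_le_of_le_one_right hr hτ.2⟩
    have h2 : τ ^ n ≤ 1 := pow_le_one₀ hτ.1.le hτ.2
    have h3 : 0 ≤ τ ^ n := pow_nonneg hτ.1.le n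
    rw [Real.norm_eq_abs, abs_mul, abs_of_nonneg h3]
    nlinarith [abs_nonneg (g (r * τ))]

theorem pow_mul_radialAvg (n : ℕ) (g : ℝ → ℝ) (r : ℝ) :
    r ^ (n + 1) * radialAvg n g r = ∫ t in (0 : ℝ)..r, g t * t ^ n := by
  have h := intervalIntegral.mul_integral_comp_mul_left (a := (0 : ℝ)) (b := 1)
    (f := fun t => g t * t ^ n) r
  simp only [mul_zero, mul_one] at h
  rw [← h, radialAvg, pow_succ', mul_assoc, ← intervalIntegral.integral_const_mul]
  congr 2
  ext τ
  ring

theorem radialAvg_zero (n : ℕ) (g : ℝ → ℝ) : radialAvg n g 0 = g 0 / (n + 1) := by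
  simp [radialAvg, intervalIntegral.integral_const_mul, integral_pow]
  field_simp

theorem hasDerivAt_integral_pow (n : ℕ) {g : ℝ → ℝ} (hg : Continuous g) (r : ℝ) :
    HasDerivAt (fun r => ∫ t in (0 : ℝ)..r, g t * t ^ n) (g r * r ^ n) r := by
  have hc : Continuous fun t : ℝ => g t * t ^ n := by fun_prop
  exact intervalIntegral.integral_hasDerivAt_right (hc.intervalIntegrable _ _)
    hc.stronglyMeasurable.stronglyMeasurableAtFilter hc.continuousAt

theorem hasDerivAt_radialAvg (n : ℕ) {g : ℝ → ℝ} (hg : Continuous g) {r : ℝ} (hr : r ≠ 0) :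
    HasDerivAt (radialAvg n g) ((g r - (n + 1) * radialAvg n g r) / r) r := by
  have h1 := hasDerivAt_integral_pow n hg r
  have h2 : HasDerivAt (fun r : ℝ => r ^ (n + 1)) (((n : ℝ) + 1) * r ^ n) r := by
    simpa using hasDerivAt_pow (n + 1) r
  have h3 := h1.div h2 (pow_ne_zero _ hr)
  refine (h3.congr_deriv ?_).congr_of_eventuallyEq ?_
  · rw [← pow_mul_radialAvg]
    field_simp
    ring
  · filter_upwards [isOpen_ne.mem_nhds hr] with x hx
    have hx' : x ≠ 0 := hx
    simp only [Pi.div_apply]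
    rw [← pow_mul_radialAvg]
    field_simp

theorem radialAvg_add (n : ℕ) {f g : ℝ → ℝ} (hf : Continuous f) (hg : Continuous g) (r : ℝ) :
    radialAvg n (fun t => f t + g t) r = radialAvg n f r + radialAvg n g r := by
  unfold radialAvg
  rw [← intervalIntegral.integral_add]
  · simp only [add_mul]
  all_goals exact Continuous.intervalIntegrable (by fun_prop) _ _

theorem radialAvg_const_mul (n : ℕ) (c : ℝ) (g : ℝ → ℝ) (r : ℝ) :
    radialAvg n (fun t => c * g t) r = c * radialAvg n g r := by
  unfold radialAvg
  rw [← intervalIntegral.integral_const_mul]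
  simp only [mul_assoc]

/-! ### The Volterra equation of the radial problem -/

/-- The projection of `ℝ` onto `[0, ρ]`. -/
def clamp (ρ r : ℝ) : ℝ := max 0 (min r ρ)

theorem continuous_clamp (ρ : ℝ) : Continuous (clamp ρ) := by unfold clamp; fun_prop

theorem clamp_nonneg (ρ r : ℝ) : 0 ≤ clamp ρ r := le_max_left _ _

theorem clamp_le_abs (ρ r : ℝ) : clamp ρ r ≤ |ρ| :=
  max_le (abs_nonneg _) ((min_le_right _ _).trans (le_abs_self _))

theorem clamp_of_mem {ρ r : ℝ} (h : r ∈ Icc 0 ρ) : clamp ρ r = r := by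
  simp [clamp, h.1, h.2]

theorem clamp_le_self {ρ r : ℝ} (h : 0 ≤ r) : clamp ρ r ≤ r :=
  max_le h (min_le_left _ _)

theorem abs_integral_mul_radialAvg_le (n : ℕ) {ρ C : ℝ} {g : ℝ → ℝ} (hC : ∀ t, |g t| ≤ C)
    (r : ℝ) : |∫ q in (0 : ℝ)..clamp ρ r, q * radialAvg n g q| ≤ |ρ| * |ρ| * C := by
  have h := intervalIntegral.norm_integral_le_of_norm_le_const (a := (0 : ℝ)) (b := clamp ρ r)
    (C := |ρ| * C) (f := fun q => q * radialAvg n g q) ?_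
  · have hC0 : 0 ≤ C := (abs_nonneg _).trans (hC 0)
    rw [Real.norm_eq_abs, sub_zero, abs_of_nonneg (clamp_nonneg ρ r)] at h
    refine h.trans ?_
    have := clamp_le_abs ρ r
    have h2 : 0 ≤ |ρ| * C := by positivity
    nlinarith
  · intro q hq
    rw [uIoc_of_le (clamp_nonneg ρ r)] at hq
    have h1 := abs_radialAvg_le n hq.1.le (fun t _ => hC t)
    rw [Real.norm_eq_abs, abs_mul, abs_of_pos hq.1]
    exact mul_le_mul (hq.2.trans (clamp_le_abs ρ r)) h1 (abs_nonneg _) (abs_nonneg _)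

theorem continuous_integral_clamp (ρ : ℝ) {f : ℝ → ℝ} (hf : Continuous f) :
    Continuous fun r => ∫ q in (0 : ℝ)..clamp ρ r, f q :=
  (intervalIntegral.continuous_primitive (fun a b => hf.intervalIntegrable a b) 0).comp
    (continuous_clamp ρ)

/-- The inverse, with value and derivative zero at `0`, of the radial Laplacian of `ℝ^{n+1}` on
`[0, ρ]`; the result is extended to `ℝ` by constants. -/
noncomputable def volterra (n : ℕ) (ρ : ℝ) : (ℝ →ᵇ ℝ) →L[ℝ] (ℝ →ᵇ ℝ) :=
  LinearMap.mkContinuous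
    { toFun := fun g => BoundedContinuousFunction.ofNormedAddCommGroup
        (fun r => ∫ q in (0 : ℝ)..clamp ρ r, q * radialAvg n g q)
        (continuous_integral_clamp ρ (continuous_id.mul (continuous_radialAvg n g.continuous)))
        (|ρ| * |ρ| * ‖g‖)
        (fun r => abs_integral_mul_radialAvg_le n (fun t => g.norm_coe_le_norm t) r)
      map_add' := by
        intro f g
        ext r
        have hf := continuous_radialAvg n f.continuous
        have hg := continuous_radialAvg n g.continuous
        simp only [BoundedContinuousFunction.coe_ofNormedAddCommGroup,
          BoundedContinuousFunction.coe_add, Pi.add_apply]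
        rw [← intervalIntegral.integral_add]
        · congr 1
          ext q
          rw [← mul_add, ← radialAvg_add n f.continuous g.continuous]
          rfl
        all_goals exact Continuous.intervalIntegrable (by fun_prop) _ _
      map_smul' := by
        intro c g
        ext r
        simp only [BoundedContinuousFunction.coe_ofNormedAddCommGroup,
          BoundedContinuousFunction.coe_smul, RingHom.id_apply, smul_eq_mul]
        rw [← intervalIntegral.integral_const_mul]
        congr 1
        ext q
        rw [mul_left_comm]
        exact congrArg _ (radialAvg_const_mul n c g q) } (|ρ| * |ρ|)
    (fun g => BoundedContinuousFunction.norm_ofNormedAddCommGroup_le _ (by positivity)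
      (fun r => abs_integral_mul_radialAvg_le n (fun t => g.norm_coe_le_norm t) r))

theorem volterra_apply (n : ℕ) (ρ : ℝ) (g : ℝ →ᵇ ℝ) (r : ℝ) :
    volterra n ρ g r = ∫ q in (0 : ℝ)..clamp ρ r, q * radialAvg n g q := rfl

/-- `g ↦ volterra (w g)`. -/
noncomputable def volterraMul (n : ℕ) (ρ : ℝ) : (ℝ →ᵇ ℝ) →L[ℝ] (ℝ →ᵇ ℝ) →L[ℝ] (ℝ →ᵇ ℝ) :=
  (ContinuousLinearMap.compL ℝ (ℝ →ᵇ ℝ) (ℝ →ᵇ ℝ) (ℝ →ᵇ ℝ) (volterra n ρ)).comp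
    (ContinuousLinearMap.mul ℝ (ℝ →ᵇ ℝ))

theorem volterraMul_apply (n : ℕ) (ρ : ℝ) (w g : ℝ →ᵇ ℝ) :
    volterraMul n ρ w g = volterra n ρ (w * g) := rfl

/-- Each application integrates once more from 0, so the iterates gain the usual Volterra factor
1/k!. -/
theorem abs_volterraMul_pow_le (n : ℕ) (ρ : ℝ) (w g : ℝ →ᵇ ℝ) (k : ℕ) (r : ℝ) :
    |(volterraMul n ρ w ^ k) g r| ≤ (|ρ| * ‖w‖) ^ k * (clamp ρ r) ^ k / k.factorial * ‖g‖ := by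
  induction k generalizing r with
  | zero => simpa using g.norm_coe_le_norm r
  | succ k ih =>
    rw [pow_succ', mul_apply_eq_comp, volterraMul_apply, volterra_apply]
    set f := (volterraMul n ρ w ^ k) g
    have hb : ∀ q ∈ Ioc 0 (clamp ρ r), ‖q * radialAvg n (w * f : ℝ →ᵇ ℝ) q‖ ≤
        ((|ρ| * ‖w‖) ^ (k + 1) / k.factorial * ‖g‖) * q ^ k := by
      intro q hq
      have h1 : |radialAvg n (w * f : ℝ →ᵇ ℝ) q| ≤
          ‖w‖ * ((|ρ| * ‖w‖) ^ k * q ^ k / k.factorial * ‖g‖) := by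
        refine abs_radialAvg_le n hq.1.le fun t ht => ?_
        rw [BoundedContinuousFunction.coe_mul, Pi.mul_apply, abs_mul]
        refine mul_le_mul (w.norm_coe_le_norm t) ((ih t).trans ?_) (abs_nonneg _) (norm_nonneg _)
        have := clamp_nonneg ρ t
        have : clamp ρ t ≤ q := (clamp_le_self ht.1).trans ht.2
        gcongr
      rw [Real.norm_eq_abs, abs_mul, abs_of_pos hq.1]
      refine (mul_le_mul (hq.2.trans (clamp_le_abs ρ r)) h1 (abs_nonneg _)
        (abs_nonneg _)).trans (le_of_eq ?_)
      ring
    have h := intervalIntegral.norm_integral_le_of_norm_le (clamp_nonneg ρ r)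
      (μ := volume) (ae_of_all _ hb) (Continuous.intervalIntegrable (by fun_prop) _ _)
    refine h.trans (le_of_eq ?_)
    rw [intervalIntegral.integral_const_mul, integral_pow, Nat.factorial_succ]
    push_cast
    field_simp
    simp

/-- Some power K^k has norm below 1, so 1 - K^k is invertible; it factors as 1 - K times a geometric
sum that commutes with 1 - K. -/
theorem isUnit_one_sub_volterraMul (n : ℕ) (ρ : ℝ) (w : ℝ →ᵇ ℝ) :
    IsUnit (1 - volterraMul n ρ w) := by
  set K := volterraMul n ρ w
  obtain ⟨k, hk⟩ : ∃ k : ℕ, (|ρ| * ‖w‖ * |ρ|) ^ k / k.factorial < 1 :=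
    ((FloorSemiring.tendsto_pow_div_factorial_atTop _).eventually_lt_const one_pos).exists
  have hn : ‖K ^ k‖ < 1 := by
    refine (ContinuousLinearMap.opNorm_le_bound _ (by positivity) fun g => ?_).trans_lt hk
    refine (BoundedContinuousFunction.norm_le (by positivity)).2 fun r => ?_
    refine (abs_volterraMul_pow_le n ρ w g k r).trans ?_
    rw [mul_pow (|ρ| * ‖w‖)]
    have := clamp_nonneg ρ r
    have := clamp_le_abs ρ r
    gcongr
  have hu : IsUnit (1 - K ^ k) := by
    have h := (Units.oneSub (K ^ k) hn).isUnit
    exact h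
  have h1 : (1 - K) * (∑ i ∈ Finset.range k, K ^ i) = 1 - K ^ k := mul_neg_geom_sum K k
  have h2 : (∑ i ∈ Finset.range k, K ^ i) * (1 - K) = 1 - K ^ k := geom_sum_mul_neg K k
  have hc : Commute (1 - K) (∑ i ∈ Finset.range k, K ^ i) := h1.trans h2.symm
  rw [← h1] at hu
  exact (hc.isUnit_mul_iff.1 hu).1

/-- The solution of `u'' + (n/r) u' = w u` on `[0, ρ]` with `u(0) = 1`, `u'(0) = 0`. -/
noncomputable def radialSol (n : ℕ) (ρ : ℝ) (w : ℝ →ᵇ ℝ) : ℝ →ᵇ ℝ :=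
  Ring.inverse (1 - volterraMul n ρ w) 1

theorem radialSol_eq (n : ℕ) (ρ : ℝ) (w : ℝ →ᵇ ℝ) :
    radialSol n ρ w = 1 + volterraMul n ρ w (radialSol n ρ w) := by
  have h := Ring.mul_inverse_cancel _ (isUnit_one_sub_volterraMul n ρ w)
  have h2 := congrArg (fun L : (ℝ →ᵇ ℝ) →L[ℝ] (ℝ →ᵇ ℝ) => L 1) h
  simp only [mul_apply_eq_comp, sub_apply,
    one_apply_eq_self] at h2
  exact sub_eq_iff_eq_add.1 h2

theorem contDiff_ringInverse_comp {R E : Type*} [NormedRing R] [NormedAlgebra ℝ R]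
    [CompleteSpace R] [NormedAddCommGroup E] [NormedSpace ℝ E] {f : E → R}
    (hf : ContDiff ℝ ∞ f) (hu : ∀ x, IsUnit (f x)) :
    ContDiff ℝ ∞ fun x => Ring.inverse (f x) := by
  refine contDiff_iff_contDiffAt.2 fun x => ?_
  obtain ⟨y, hy⟩ := hu x
  have h1 := contDiffAt_ringInverse (n := ∞) ℝ y
  rw [hy] at h1
  exact h1.comp x hf.contDiffAt

/-- The potential enters the operator linearly, and inversion is smooth on the units of a Banach
algebra. Clamping to [0, ρ] makes one fixed space of bounded continuous functions serve for all
potentials. -/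
theorem contDiff_radialSol (n : ℕ) (ρ : ℝ) : ContDiff ℝ ∞ (radialSol n ρ) := by
  have hc : ContDiff ℝ ∞ (fun w => volterraMul n ρ w) :=
    ContinuousLinearMap.contDiff (𝕜 := ℝ) (E := ℝ →ᵇ ℝ) (F := (ℝ →ᵇ ℝ) →L[ℝ] (ℝ →ᵇ ℝ))
      (volterraMul n ρ)
  have h := contDiff_ringInverse_comp (R := (ℝ →ᵇ ℝ) →L[ℝ] (ℝ →ᵇ ℝ))
    (f := fun w => 1 - volterraMul n ρ w) (contDiff_const.sub hc)
    (isUnit_one_sub_volterraMul n ρ)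
  exact h.clm_apply contDiff_const

theorem hasDerivAt_volterra (n : ℕ) {ρ : ℝ} (g : ℝ →ᵇ ℝ) {r : ℝ} (hr : r ∈ Ioo 0 ρ) :
    HasDerivAt (volterra n ρ g) (r * radialAvg n g r) r := by
  have hc : Continuous fun q : ℝ => q * radialAvg n g q :=
    continuous_id.mul (continuous_radialAvg n g.continuous)
  have h := intervalIntegral.integral_hasDerivAt_right (hc.intervalIntegrable 0 r)
    hc.stronglyMeasurable.stronglyMeasurableAtFilter hc.continuousAt
  refine h.congr_of_eventuallyEq ?_
  filter_upwards [isOpen_Ioo.mem_nhds hr] with x hx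
  rw [volterra_apply, clamp_of_mem (Ioo_subset_Icc_self hx)]

theorem volterra_zero (n : ℕ) (ρ : ℝ) (g : ℝ →ᵇ ℝ) : volterra n ρ g 0 = 0 := by
  rw [volterra_apply, le_antisymm (clamp_le_self le_rfl) (clamp_nonneg ρ 0)]
  simp

/-! ### Radial pairs and Wronskian comparison -/

/-- `g' = r b` and `g'' + (n/r) g' = k` on `(0, ρ)`, with `g` and `b` continuous on `[0, ρ]`. -/
structure IsRadialPair (n : ℕ) (ρ : ℝ) (g b k : ℝ → ℝ) : Prop where
  continuousOn : ContinuousOn g (Icc 0 ρ)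
  continuousOn_slope : ContinuousOn b (Icc 0 ρ)
  hasDerivAt : ∀ r ∈ Ioo 0 ρ, HasDerivAt g (r * b r) r
  hasDerivAt_slope : ∀ r ∈ Ioo 0 ρ, HasDerivAt b ((k r - (n + 1) * b r) / r) r

theorem IsRadialPair.mono {n : ℕ} {ρ R : ℝ} {g b k : ℝ → ℝ} (h : IsRadialPair n ρ g b k)
    (hR : R ≤ ρ) : IsRadialPair n R g b k :=
  ⟨h.1.mono (Icc_subset_Icc_right hR), h.2.mono (Icc_subset_Icc_right hR),
    fun r hr => h.3 r (Ioo_subset_Ioo_right hR hr),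
    fun r hr => h.4 r (Ioo_subset_Ioo_right hR hr)⟩

/-- The weighted Wronskian `r^{n+1} (b u - g a)` of two pairs. -/
def wronskian (n : ℕ) (g b u a : ℝ → ℝ) (r : ℝ) : ℝ := r ^ (n + 1) * (b r * u r - g r * a r)

section Wronskian

variable {n : ℕ} {ρ : ℝ} {g b k u a l : ℝ → ℝ}

theorem hasDerivAt_wronskian (hg : IsRadialPair n ρ g b k) (hu : IsRadialPair n ρ u a l)
    {r : ℝ} (hr : r ∈ Ioo 0 ρ) :
    HasDerivAt (wronskian n g b u a) (r ^ n * (k r * u r - g r * l r)) r := by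
  have h1 : HasDerivAt (fun r : ℝ => r ^ (n + 1)) (((n : ℝ) + 1) * r ^ n) r := by
    simpa using hasDerivAt_pow (n + 1) r
  have h := h1.mul (((hg.4 r hr).mul (hu.3 r hr)).sub ((hg.3 r hr).mul (hu.4 r hr)))
  refine h.congr_deriv ?_
  have hr0 : r ≠ 0 := hr.1.ne'
  simp only [Pi.sub_apply, Pi.mul_apply]
  field_simp
  ring

theorem continuousOn_wronskian (hg : IsRadialPair n ρ g b k) (hu : IsRadialPair n ρ u a l) :
    ContinuousOn (wronskian n g b u a) (Icc 0 ρ) :=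
  (continuous_pow (n + 1)).continuousOn.mul
    ((hg.2.mul hu.1).sub (hg.1.mul hu.2))

theorem wronskian_zero : wronskian n g b u a 0 = 0 := by simp [wronskian]

/-- Sturm comparison. The factor r^{n+1} kills the Wronskian at the centre, so its sign at ρ is
decided by its derivative alone. -/
theorem pos_of_wronskian_deriv_pos (hρ : 0 < ρ) (hg : IsRadialPair n ρ g b k)
    (hu : IsRadialPair n ρ u a l) (h : ∀ r ∈ Ioo 0 ρ, 0 < k r * u r - g r * l r) :
    0 < b ρ * u ρ - g ρ * a ρ := by
  have hm : StrictMonoOn (wronskian n g b u a) (Icc 0 ρ) := by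
    refine strictMonoOn_of_deriv_pos (convex_Icc 0 ρ) (continuousOn_wronskian hg hu) fun r hr => ?_
    rw [interior_Icc] at hr
    rw [(hasDerivAt_wronskian hg hu hr).deriv]
    exact mul_pos (pow_pos hr.1 n) (h r hr)
  have h1 := hm (left_mem_Icc.2 hρ.le) (right_mem_Icc.2 hρ.le) hρ
  rw [wronskian_zero] at h1
  exact pos_of_mul_pos_right h1 (pow_pos hρ _).le

theorem integral_wronskian_deriv (hρ : 0 < ρ) (hg : IsRadialPair n ρ g b k)
    (hu : IsRadialPair n ρ u a l)
    (hi : IntervalIntegrable (fun r => r ^ n * (k r * u r - g r * l r)) volume 0 ρ) :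
    ∫ r in (0 : ℝ)..ρ, r ^ n * (k r * u r - g r * l r) = ρ ^ (n + 1) * (b ρ * u ρ - g ρ * a ρ) := by
  rw [intervalIntegral.integral_eq_sub_of_hasDerivAt_of_le hρ.le (continuousOn_wronskian hg hu)
    (fun r hr => hasDerivAt_wronskian hg hu hr) hi, wronskian_zero, sub_zero]
  rfl

end Wronskian

/-! ### The radial solution and its first zero -/

/-- `a` with `u' = r a`, for the solution `u` with potential `w`. -/
noncomputable def radialSlope (n : ℕ) (ρ : ℝ) (w : ℝ →ᵇ ℝ) : ℝ → ℝ :=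
  radialAvg n (w * radialSol n ρ w : ℝ →ᵇ ℝ)

theorem continuous_radialSlope (n : ℕ) (ρ : ℝ) (w : ℝ →ᵇ ℝ) :
    Continuous (radialSlope n ρ w) :=
  continuous_radialAvg n (w * radialSol n ρ w).continuous

theorem radialSol_apply (n : ℕ) (ρ : ℝ) (w : ℝ →ᵇ ℝ) (r : ℝ) :
    radialSol n ρ w r = 1 + volterra n ρ (w * radialSol n ρ w) r := by
  have h := congrArg (fun f : ℝ →ᵇ ℝ => f r) (radialSol_eq n ρ w)
  exact h

theorem radialSol_zero (n : ℕ) (ρ : ℝ) (w : ℝ →ᵇ ℝ) : radialSol n ρ w 0 = 1 := by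
  rw [radialSol_apply, volterra_zero, add_zero]

theorem isRadialPair_volterra (n : ℕ) (ρ : ℝ) (g : ℝ →ᵇ ℝ) :
    IsRadialPair n ρ (volterra n ρ g) (radialAvg n g) g :=
  ⟨(volterra n ρ g).continuous.continuousOn, (continuous_radialAvg n g.continuous).continuousOn,
    fun _ hr => hasDerivAt_volterra n g hr,
    fun _ hr => hasDerivAt_radialAvg n g.continuous hr.1.ne'⟩

theorem isRadialPair_radialSol (n : ℕ) (ρ : ℝ) (w : ℝ →ᵇ ℝ) :
    IsRadialPair n ρ (radialSol n ρ w) (radialSlope n ρ w) (fun r => w r * radialSol n ρ w r) := by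
  have h := isRadialPair_volterra n ρ (w * radialSol n ρ w)
  refine ⟨(radialSol n ρ w).continuous.continuousOn, h.2, fun r hr => ?_, h.4⟩
  have h1 := (h.3 r hr).const_add 1
  exact h1.congr_of_eventuallyEq (Eventually.of_forall fun x => radialSol_apply n ρ w x)

theorem exists_first_zero {u : ℝ → ℝ} {R : ℝ} (hu : ContinuousOn u (Icc 0 R)) (h0 : 0 < u 0)
    {r : ℝ} (hr : r ∈ Icc 0 R) (h : u r ≤ 0) :
    ∃ z ∈ Ioc 0 R, u z = 0 ∧ ∀ t ∈ Ico 0 z, 0 < u t := by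
  have hc : IsCompact (Icc 0 R ∩ u ⁻¹' Iic 0) :=
    isCompact_Icc.of_isClosed_subset (hu.preimage_isClosed_of_isClosed isClosed_Icc isClosed_Iic)
      inter_subset_left
  obtain ⟨z, hz, hmin⟩ := hc.exists_isLeast ⟨r, hr, h⟩
  have hz0 : 0 < z := by
    rcases hz.1.1.eq_or_lt with h1 | h1
    · subst h1
      exact absurd hz.2 (not_le.2 h0)
    · exact h1
  have hpos : ∀ t ∈ Ico 0 z, 0 < u t := by
    intro t ht
    by_contra hcon
    exact absurd (hmin ⟨⟨ht.1, ht.2.le.trans hz.1.2⟩, not_lt.1 hcon⟩) (not_le.2 ht.2)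
  refine ⟨z, ⟨hz0, hz.1.2⟩, le_antisymm hz.2 ?_, hpos⟩
  have h3 : Tendsto u (𝓝[Ico 0 z] z) (𝓝 (u z)) :=
    (hu z hz.1).mono fun t ht => ⟨ht.1, ht.2.le.trans hz.1.2⟩
  have h4 : (𝓝[Ico 0 z] z).NeBot := by
    rw [← mem_closure_iff_nhdsWithin_neBot, closure_Ico hz0.ne]
    exact right_mem_Icc.2 hz0.le
  exact ge_of_tendsto h3 (eventually_nhdsWithin_of_forall fun t ht => (hpos t ht).le)

/-- Up to a first zero the average of w u is nonnegative, so u is nondecreasing from 1 and cannot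
reach 0. -/
theorem radialSol_pos_of_nonneg (n : ℕ) {ρ : ℝ} {w : ℝ →ᵇ ℝ} (hw : ∀ r ∈ Icc 0 ρ, 0 ≤ w r) {r : ℝ}
    (hr : r ∈ Icc 0 ρ) : 0 < radialSol n ρ w r := by
  by_contra hcon
  have hc := (radialSol n ρ w).continuous
  obtain ⟨z, hz, hz0, hpos⟩ := exists_first_zero hc.continuousOn
    (by rw [radialSol_zero]; exact one_pos) hr (not_lt.1 hcon)
  have hp := (isRadialPair_radialSol n ρ w).mono hz.2
  have hm : MonotoneOn (radialSol n ρ w) (Icc 0 z) := by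
    refine monotoneOn_of_deriv_nonneg (convex_Icc 0 z) hc.continuousOn ?_ ?_
    · rw [interior_Icc]
      exact fun t ht => (hp.3 t ht).differentiableAt.differentiableWithinAt
    · rw [interior_Icc]
      intro t ht
      rw [(hp.3 t ht).deriv]
      refine mul_nonneg ht.1.le (intervalIntegral.integral_nonneg zero_le_one fun τ hτ => ?_)
      have h1 : t * τ ≤ t := mul_le_of_le_one_right ht.1.le hτ.2
      have h2 : 0 ≤ t * τ := mul_nonneg ht.1.le hτ.1
      exact mul_nonneg (mul_nonneg (hw _ ⟨h2, h1.trans (ht.2.le.trans hz.2)⟩)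
        (hpos _ ⟨h2, h1.trans_lt ht.2⟩).le) (pow_nonneg hτ.1 n)
  have h := hm (left_mem_Icc.2 hz.1.le) (right_mem_Icc.2 hz.1.le) hz.1.le
  rw [radialSol_zero, hz0] at h
  linarith

/-! ### Existence of the ground energy -/

/-- The potential `σ V - E`. -/
noncomputable def pot (V : ℝ →ᵇ ℝ) (σ E : ℝ) : ℝ →ᵇ ℝ := σ • V - E • (1 : ℝ →ᵇ ℝ)

theorem pot_apply (V : ℝ →ᵇ ℝ) (σ E r : ℝ) : pot V σ E r = σ * V r - E := by
  simp [pot]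

/-- The radial solution of `-Δ u + σ V u = E u` is positive in the open ball of radius `ρ` and
has a simple zero on its boundary. -/
structure IsGround (n : ℕ) (ρ : ℝ) (V : ℝ →ᵇ ℝ) (σ E : ℝ) : Prop where
  energy_pos : 0 < E
  pos : ∀ r ∈ Ico 0 ρ, 0 < radialSol n ρ (pot V σ E) r
  zero : radialSol n ρ (pot V σ E) ρ = 0
  slope_neg : radialSlope n ρ (pot V σ E) ρ < 0

theorem isRadialPair_sq (n : ℕ) (ρ : ℝ) :
    IsRadialPair n ρ (fun r => (ρ ^ 2 - r ^ 2) ^ 2) (fun r => -4 * (ρ ^ 2 - r ^ 2))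
      (fun r => -4 * (n + 1) * (ρ ^ 2 - r ^ 2) + 8 * r ^ 2) := by
  refine ⟨by fun_prop, by fun_prop, fun r hr => ?_, fun r hr => ?_⟩
  · have h := ((hasDerivAt_pow 2 r).const_sub (ρ ^ 2)).pow 2
    refine h.congr_deriv ?_
    push_cast
    ring
  · have h := ((hasDerivAt_pow 2 r).const_sub (ρ ^ 2)).const_mul (-4)
    refine h.congr_deriv ?_
    have := hr.1.ne'
    push_cast
    field_simp
    ring

/-- Comparison with (ρ² - r²)², which vanishes at ρ together with its slope: the Wronskian at ρ is
then 0 whatever the solution does there, while a larger E would make it positive. -/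
theorem energy_le_of_pos (n : ℕ) {ρ : ℝ} (hρ : 0 < ρ) (V : ℝ →ᵇ ℝ) {σ E : ℝ} (hσ : 0 ≤ σ)
    (hpos : ∀ r ∈ Ico 0 ρ, 0 < radialSol n ρ (pot V σ E) r) :
    E ≤ σ * ‖V‖ + (4 * n + 12) ^ 2 / (32 * ρ ^ 2) := by
  by_contra hcon
  have h := pos_of_wronskian_deriv_pos hρ (isRadialPair_sq n ρ)
    (isRadialPair_radialSol n ρ (pot V σ E)) ?_
  · simp at h
  intro r hr
  have hu := hpos r (Ioo_subset_Ico_self hr)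
  have hV : V r ≤ ‖V‖ := (le_abs_self _).trans (V.norm_coe_le_norm r)
  set z := ρ ^ 2 - r ^ 2 with hz
  have hz0 : 0 < z := by have := hr.1; have := hr.2; nlinarith
  have hr2 : r ^ 2 = ρ ^ 2 - z := by ring
  rw [pot_apply, ← mul_assoc, ← sub_mul, hr2]
  refine mul_pos ?_ hu
  -- The arithmetic-geometric mean inequality: the source of the comparison function is 8ρ² -
  -- (4n+12) z, and its negative part is absorbed by a multiple of z².
  have h1 : (4 * n + 12) * z ≤ 8 * ρ ^ 2 + (4 * n + 12) ^ 2 / (32 * ρ ^ 2) * z ^ 2 := by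
    have h2 : 8 * ρ ^ 2 + (4 * n + 12) ^ 2 / (32 * ρ ^ 2) * z ^ 2 - (4 * n + 12) * z
      = ((4 * n + 12) * z - 16 * ρ ^ 2) ^ 2 / (32 * ρ ^ 2) := by field_simp; ring
    have h3 : 0 ≤ ((4 * n + 12) * z - 16 * ρ ^ 2) ^ 2 / (32 * ρ ^ 2) := by positivity
    linarith
  have h4 : σ * V r ≤ σ * ‖V‖ := mul_le_mul_of_nonneg_left hV hσ
  have h5 : 0 < z ^ 2 * (E - (σ * V r + (4 * n + 12) ^ 2 / (32 * ρ ^ 2))) :=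
    mul_pos (by positivity) (by linarith [not_le.1 hcon])
  nlinarith

theorem continuous_pot (V : ℝ →ᵇ ℝ) (σ : ℝ) : Continuous (pot V σ) := by
  unfold pot; fun_prop

/-- The energies whose solution is positive on all of [0, ρ] form an open set, bounded above and
containing 0. At its supremum the solution is still nonnegative but has a zero, and this zero can
only be at ρ. -/
theorem exists_isGround (n : ℕ) {ρ : ℝ} (hρ : 0 < ρ) {V : ℝ →ᵇ ℝ} (hV : ∀ r ∈ Icc 0 ρ, 0 ≤ V r)
    {σ : ℝ} (hσ : 0 ≤ σ) : ∃ E, IsGround n ρ V σ E := by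
  set u : ℝ → (ℝ →ᵇ ℝ) := fun E => radialSol n ρ (pot V σ E) with hu
  have hcu : Continuous u := (contDiff_radialSol n ρ).continuous.comp (continuous_pot V σ)
  set A : Set ℝ := {E | ∀ r ∈ Icc 0 ρ, 0 < u E r} with hA
  have h0A : (0 : ℝ) ∈ A := fun r hr => radialSol_pos_of_nonneg n (fun t ht => by
    rw [pot_apply, sub_zero]; exact mul_nonneg hσ (hV t ht)) hr
  have hbdd : BddAbove A := ⟨_, fun E hE =>
    energy_le_of_pos n hρ V hσ fun r hr => hE r (Ico_subset_Icc_self hr)⟩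
  have hopen : IsOpen A := by
    refine isOpen_iff_mem_nhds.2 fun E hE => ?_
    obtain ⟨m, hm, hmin⟩ := isCompact_Icc.exists_isMinOn (nonempty_Icc.2 hρ.le)
      (u E).continuous.continuousOn
    have hev : ∀ᶠ E' in 𝓝 E, dist (u E') (u E) < u E m :=
      (tendsto_iff_dist_tendsto_zero.1 (hcu.tendsto E)).eventually_lt_const (hE m hm)
    filter_upwards [hev] with E' hE' r hr
    have h1 : |u E' r - u E r| < u E m := (BoundedContinuousFunction.dist_coe_le_dist r).trans_lt hE'
    have h2 := (abs_lt.1 h1).1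
    have h3 : u E m ≤ u E r := hmin hr
    linarith
  set E := sSup A with hE
  have hEA : E ∉ A := by
    intro h
    have h1 : ∀ᶠ x in 𝓝[>] E, x ∈ A := mem_nhdsWithin_of_mem_nhds (hopen.mem_nhds h)
    obtain ⟨E', hE', hlt⟩ := (Filter.Eventually.and h1 self_mem_nhdsWithin).exists
    exact absurd (le_csSup hbdd hE') (not_le.2 hlt)
  have hE0 : 0 < E := by
    refine lt_of_le_of_ne (le_csSup hbdd h0A) fun h => hEA (h ▸ h0A)
  have hnn : ∀ r ∈ Icc 0 ρ, 0 ≤ u E r := by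
    intro r hr
    have hcl : E ∈ closure A := csSup_mem_closure ⟨0, h0A⟩ hbdd
    have hc : Continuous fun E' => u E' r :=
      (BoundedContinuousFunction.evalCLM ℝ r).continuous.comp hcu
    exact closure_minimal (fun E' hE' => (hE' r hr).le)
      (isClosed_le continuous_const hc) hcl
  obtain ⟨r, hr, hr0⟩ : ∃ r ∈ Icc 0 ρ, u E r ≤ 0 := by
    by_contra! h
    exact hEA h
  obtain ⟨z, hz, hz0, hpos⟩ := exists_first_zero (u E).continuous.continuousOn
    (by rw [hu]; simp only [radialSol_zero]; exact one_pos) hr hr0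
  -- Comparison with the solution of energy 0, positive up to ρ, makes the slope at the first zero
  -- strictly negative.
  have hW := pos_of_wronskian_deriv_pos hz.1 ((isRadialPair_radialSol n ρ (pot V σ 0)).mono hz.2)
    ((isRadialPair_radialSol n ρ (pot V σ E)).mono hz.2) (fun t ht => by
      have h1 := h0A t ⟨ht.1.le, ht.2.le.trans hz.2⟩
      have h2 := hpos t (Ioo_subset_Ico_self ht)
      rw [pot_apply, pot_apply]
      have h3 : 0 < E * (u 0 t * u E t) := by positivity
      have h4 : u 0 t = radialSol n ρ (pot V σ 0) t := rfl
      have h5 : u E t = radialSol n ρ (pot V σ E) t := rfl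
      rw [← h4, ← h5]
      linarith)
  have hz0' : radialSol n ρ (pot V σ E) z = 0 := hz0
  rw [hz0', mul_zero, zero_sub, neg_pos] at hW
  have hslope : radialSlope n ρ (pot V σ E) z < 0 :=
    neg_of_mul_neg_right hW (h0A z (Ioc_subset_Icc_self hz)).le
  rcases hz.2.eq_or_lt with h | h
  · subst h
    exact ⟨E, hE0, hpos, hz0, hslope⟩
  -- A zero inside the interval would be a minimum of a nonnegative function, with zero derivative,
  -- against the negative slope.
  · exfalso
    have hd := (isRadialPair_radialSol n ρ (pot V σ E)).3 z ⟨hz.1, h⟩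
    have hmin : IsLocalMin (u E) z := by
      filter_upwards [isOpen_Ioo.mem_nhds (show z ∈ Ioo 0 ρ from ⟨hz.1, h⟩)] with t ht
      rw [hz0]
      exact hnn t (Ioo_subset_Icc_self ht)
    have h1 := hmin.hasDerivAt_eq_zero hd
    have h2 := mul_neg_of_pos_of_neg hz.1 hslope
    exact h2.ne h1

/-! ### The energy as a smooth function of the coupling -/

/-- The functional `g ↦ ∫₀^ρ g(t) tⁿ dt`. -/
noncomputable def radialInt (n : ℕ) (ρ : ℝ) : (ℝ →ᵇ ℝ) →L[ℝ] ℝ :=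
  LinearMap.mkContinuous
    { toFun := fun g => ∫ t in (0 : ℝ)..ρ, g t * t ^ n
      map_add' := by
        intro f g
        have hf := f.continuous
        have hg := g.continuous
        rw [← intervalIntegral.integral_add]
        · simp [add_mul]
        all_goals exact Continuous.intervalIntegrable (by fun_prop) _ _
      map_smul' := by
        intro c g
        simp only [BoundedContinuousFunction.coe_smul, RingHom.id_apply, smul_eq_mul]
        rw [← intervalIntegral.integral_const_mul]
        simp only [mul_assoc] } (|ρ| ^ n * |ρ|)
    (fun g => by
      have h := intervalIntegral.norm_integral_le_of_norm_le_const (a := (0 : ℝ)) (b := ρ)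
        (C := |ρ| ^ n * ‖g‖) (f := fun t => g t * t ^ n) (fun t ht => by
          rw [norm_mul, norm_pow, mul_comm]
          have h1 : |t| ≤ |ρ| := by
            rcases le_total 0 ρ with h0 | h0
            · rw [uIoc_of_le h0] at ht
              rw [abs_of_pos ht.1, abs_of_nonneg h0]
              exact ht.2
            · rw [uIoc_of_ge h0] at ht
              rw [abs_of_nonpos ht.2, abs_of_nonpos h0]
              linarith [ht.1]
          exact mul_le_mul (pow_le_pow_left₀ (abs_nonneg t) h1 n) (g.norm_coe_le_norm t)
            (norm_nonneg _) (by positivity))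
      rw [sub_zero] at h
      refine h.trans (le_of_eq ?_)
      ring)

theorem radialInt_apply (n : ℕ) (ρ : ℝ) (g : ℝ →ᵇ ℝ) :
    radialInt n ρ g = ∫ t in (0 : ℝ)..ρ, g t * t ^ n := rfl

theorem radialInt_pos (n : ℕ) {ρ : ℝ} (hρ : 0 < ρ) {g : ℝ →ᵇ ℝ} (hg : ∀ r ∈ Ioo 0 ρ, 0 < g r) :
    0 < radialInt n ρ g := by
  rw [radialInt_apply]
  have hc := g.continuous
  exact intervalIntegral.intervalIntegral_pos_of_pos_on
    (Continuous.intervalIntegrable (by fun_prop) _ _)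
    (fun t ht => mul_pos (hg t ht) (pow_pos ht.1 n)) hρ

/-- Green's identity for two ground states: both vanish at ρ, so the boundary Wronskian drops out.
The identity is exact, which gives the Lipschitz bound and then the derivative of the energy. -/
theorem IsGround.sub_mul_radialInt {n : ℕ} {ρ : ℝ} (hρ : 0 < ρ) {V : ℝ →ᵇ ℝ} {σ₁ σ₂ E₁ E₂ : ℝ}
    (h₁ : IsGround n ρ V σ₁ E₁) (h₂ : IsGround n ρ V σ₂ E₂) :
    (E₁ - E₂) * radialInt n ρ (radialSol n ρ (pot V σ₁ E₁) * radialSol n ρ (pot V σ₂ E₂))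
      = (σ₁ - σ₂) *
        radialInt n ρ (V * (radialSol n ρ (pot V σ₁ E₁) * radialSol n ρ (pot V σ₂ E₂))) := by
  have h := integral_wronskian_deriv hρ (isRadialPair_radialSol n ρ (pot V σ₁ E₁))
    (isRadialPair_radialSol n ρ (pot V σ₂ E₂))
    (Continuous.intervalIntegrable (by fun_prop) _ _)
  rw [h₁.zero, h₂.zero, mul_zero, zero_mul, sub_zero, mul_zero] at h
  set u₁ := radialSol n ρ (pot V σ₁ E₁)
  set u₂ := radialSol n ρ (pot V σ₂ E₂)
  have h2 : radialInt n ρ ((σ₁ - σ₂) • (V * (u₁ * u₂)) - (E₁ - E₂) • (u₁ * u₂)) = 0 := by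
    rw [radialInt_apply, ← h]
    congr 1
    ext t
    simp only [BoundedContinuousFunction.coe_sub, BoundedContinuousFunction.coe_smul,
      BoundedContinuousFunction.coe_mul, Pi.sub_apply, Pi.mul_apply, smul_eq_mul, pot_apply]
    ring
  rw [map_sub, map_smul, map_smul, smul_eq_mul, smul_eq_mul] at h2
  linarith

theorem IsGround.mul_pos_on {n : ℕ} {ρ : ℝ} {V : ℝ →ᵇ ℝ} {σ₁ σ₂ E₁ E₂ : ℝ}
    (h₁ : IsGround n ρ V σ₁ E₁) (h₂ : IsGround n ρ V σ₂ E₂) :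
    ∀ r ∈ Ioo 0 ρ, 0 < (radialSol n ρ (pot V σ₁ E₁) * radialSol n ρ (pot V σ₂ E₂)) r :=
  fun r hr => mul_pos (h₁.pos r (Ioo_subset_Ico_self hr)) (h₂.pos r (Ioo_subset_Ico_self hr))

theorem IsGround.abs_sub_le {n : ℕ} {ρ : ℝ} (hρ : 0 < ρ) {V : ℝ →ᵇ ℝ} {σ₁ σ₂ E₁ E₂ : ℝ}
    (h₁ : IsGround n ρ V σ₁ E₁) (h₂ : IsGround n ρ V σ₂ E₂) :
    |E₁ - E₂| ≤ ‖V‖ * |σ₁ - σ₂| := by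
  have h := congrArg abs (h₁.sub_mul_radialInt hρ h₂)
  have hp := h₁.mul_pos_on h₂
  set f := radialSol n ρ (pot V σ₁ E₁) * radialSol n ρ (pot V σ₂ E₂)
  have hI := radialInt_pos n hρ hp
  have hb : |radialInt n ρ (V * f)| ≤ ‖V‖ * radialInt n ρ f := by
    rw [radialInt_apply, radialInt_apply, ← intervalIntegral.integral_const_mul,
      ← Real.norm_eq_abs]
    have hc := f.continuous
    refine intervalIntegral.norm_integral_le_of_norm_le hρ.le ?_
      (Continuous.intervalIntegrable (by fun_prop) _ _)
    filter_upwards [show ∀ᵐ t : ℝ, t ≠ ρ from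
      (measure_eq_zero_iff_ae_notMem.1 (measure_singleton ρ))] with t ht hm
    have hft := hp t ⟨hm.1, lt_of_le_of_ne hm.2 ht⟩
    rw [BoundedContinuousFunction.coe_mul, Pi.mul_apply, mul_assoc, norm_mul,
      Real.norm_of_nonneg (mul_nonneg hft.le (pow_nonneg hm.1.le n))]
    exact mul_le_mul_of_nonneg_right (V.norm_coe_le_norm t)
      (mul_nonneg hft.le (pow_nonneg hm.1.le n))
  rw [abs_mul, abs_mul, abs_of_pos hI] at h
  refine le_of_mul_le_mul_right ?_ hI
  rw [h]
  calc |σ₁ - σ₂| * |radialInt n ρ (V * f)| ≤ |σ₁ - σ₂| * (‖V‖ * radialInt n ρ f) := by gcongr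
    _ = _ := by ring

section GroundCurve

variable {n : ℕ} {ρ : ℝ} {V : ℝ →ᵇ ℝ} {e : ℝ → ℝ}

/-- The radial solution with energy `e(σ)`. -/
noncomputable def groundSol (n : ℕ) (ρ : ℝ) (V : ℝ →ᵇ ℝ) (e : ℝ → ℝ) (σ : ℝ) : ℝ →ᵇ ℝ :=
  radialSol n ρ (pot V σ (e σ))

theorem contDiffOn_groundSol {k : WithTop ℕ∞} (hk : k ≤ ∞) {s : Set ℝ} (he : ContDiffOn ℝ k e s) :
    ContDiffOn ℝ k (groundSol n ρ V e) s := by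
  have h : ContDiffOn ℝ k (fun σ => pot V σ (e σ)) s := by
    unfold pot
    exact (contDiffOn_id.smul contDiffOn_const).sub (he.smul contDiffOn_const)
  exact ((contDiff_radialSol n ρ).of_le hk).comp_contDiffOn h

theorem continuousOn_ground (hρ : 0 < ρ) (he : ∀ σ, 0 < σ → IsGround n ρ V σ (e σ)) :
    ContinuousOn e (Ioi 0) := by
  intro σ hσ
  refine tendsto_iff_dist_tendsto_zero.2 ?_
  have h : Tendsto (fun σ' => ‖V‖ * |σ' - σ|) (𝓝[Ioi 0] σ) (𝓝 0) := by
    have hc : Continuous fun σ' : ℝ => ‖V‖ * |σ' - σ| := by fun_prop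
    have h1 := (hc.tendsto σ).mono_left (nhdsWithin_le_nhds (s := Ioi 0))
    simpa using h1
  refine squeeze_zero' (Eventually.of_forall fun _ => dist_nonneg) ?_ h
  filter_upwards [self_mem_nhdsWithin] with σ' hσ'
  exact (he σ' hσ').abs_sub_le hρ (he σ hσ)

theorem radialInt_groundSol_sq_pos (hρ : 0 < ρ) {σ : ℝ} (h : IsGround n ρ V σ (e σ)) :
    0 < radialInt n ρ (groundSol n ρ V e σ * groundSol n ρ V e σ) :=
  radialInt_pos n hρ (h.mul_pos_on h)

/-- Hellmann–Feynman. The difference quotient equals the ratio of the integrals of V u_{σ'} u_σ and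
u_{σ'} u_σ, and continuity of σ' ↦ u_{σ'} gives the limit. -/
theorem hasDerivAt_ground (hρ : 0 < ρ) (he : ∀ σ, 0 < σ → IsGround n ρ V σ (e σ)) {σ : ℝ}
    (hσ : 0 < σ) :
    HasDerivAt e (radialInt n ρ (V * (groundSol n ρ V e σ * groundSol n ρ V e σ)) /
      radialInt n ρ (groundSol n ρ V e σ * groundSol n ρ V e σ)) σ := by
  rw [hasDerivAt_iff_tendsto_slope]
  have hc : ContinuousAt (groundSol n ρ V e) σ := by
    have h0 : ContDiffOn ℝ 0 e (Ioi 0) := contDiffOn_zero.2 (continuousOn_ground hρ he)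
    exact ((contDiffOn_groundSol (by simp) h0).continuousOn).continuousAt (Ioi_mem_nhds hσ)
  set u := groundSol n ρ V e with hu
  have h1 : ContinuousAt (fun σ' => radialInt n ρ (V * (u σ' * u σ)) /
      radialInt n ρ (u σ' * u σ)) σ := by
    refine ContinuousAt.div ?_ ?_ (radialInt_groundSol_sq_pos hρ (he σ hσ)).ne'
    · exact (radialInt n ρ).continuous.continuousAt.comp
        (continuousAt_const.mul (hc.mul continuousAt_const))
    · exact (radialInt n ρ).continuous.continuousAt.comp (hc.mul continuousAt_const)
  refine Tendsto.congr' ?_ (h1.tendsto.mono_left nhdsWithin_le_nhds)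
  filter_upwards [self_mem_nhdsWithin, mem_nhdsWithin_of_mem_nhds (Ioi_mem_nhds hσ)]
    with σ' hne hσ'
  have h2 := (he σ' hσ').sub_mul_radialInt hρ (he σ hσ)
  have h3 := radialInt_pos n hρ ((he σ' hσ').mul_pos_on (he σ hσ))
  have h4 : σ' - σ ≠ 0 := sub_ne_zero.2 hne
  rw [slope_def_field]
  change radialInt n ρ (V * (radialSol n ρ (pot V σ' (e σ')) * radialSol n ρ (pot V σ (e σ)))) /
    radialInt n ρ (radialSol n ρ (pot V σ' (e σ')) * radialSol n ρ (pot V σ (e σ))) = _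
  rw [div_eq_div_iff h3.ne' h4]
  linarith

/-- Bootstrap: if e is C^k, so is σ ↦ u_σ, hence so is e' by the Hellmann–Feynman quotient, and e is
C^{k+1}. -/
theorem contDiffOn_ground (hρ : 0 < ρ) (he : ∀ σ, 0 < σ → IsGround n ρ V σ (e σ)) :
    ContDiffOn ℝ ∞ e (Ioi 0) := by
  refine contDiffOn_infty.2 fun k => ?_
  induction k with
  | zero => exact contDiffOn_zero.2 (continuousOn_ground hρ he)
  | succ k ih =>
    push_cast
    refine (contDiffOn_succ_iff_deriv_of_isOpen isOpen_Ioi).2 ⟨?_, by simp, ?_⟩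
    · exact fun σ hσ => (hasDerivAt_ground hρ he hσ).differentiableAt.differentiableWithinAt
    · have hu : ContDiffOn ℝ k (groundSol n ρ V e) (Ioi 0) :=
        contDiffOn_groundSol (mod_cast le_top) ih
      refine ContDiffOn.congr ?_ (fun σ hσ => (hasDerivAt_ground hρ he hσ).deriv)
      refine ContDiffOn.div ?_ ?_ fun σ hσ => (radialInt_groundSol_sq_pos hρ (he σ hσ)).ne'
      · exact (radialInt n ρ).contDiff.comp_contDiffOn (contDiffOn_const.mul (hu.mul hu))
      · exact (radialInt n ρ).contDiff.comp_contDiffOn (hu.mul hu)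

theorem hasDerivAt_groundSol (hρ : 0 < ρ) (he : ∀ σ, 0 < σ → IsGround n ρ V σ (e σ)) {σ : ℝ}
    (hσ : 0 < σ) :
    HasDerivAt (groundSol n ρ V e) (deriv (groundSol n ρ V e) σ) σ :=
  (((contDiffOn_groundSol le_rfl (contDiffOn_ground hρ he)).contDiffAt
    (Ioi_mem_nhds hσ)).differentiableAt (by simp)).hasDerivAt

/-- Differentiating u = 1 + `volterra` (w u) in σ: the variation solves the linearized radial
equation with zero data at the centre. Here `pot V 1 (deriv e σ)` is the derivative V - e' of the
potential. -/
theorem deriv_groundSol_eq (hρ : 0 < ρ) (he : ∀ σ, 0 < σ → IsGround n ρ V σ (e σ)) {σ : ℝ}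
    (hσ : 0 < σ) :
    deriv (groundSol n ρ V e) σ = volterra n ρ (pot V 1 (deriv e σ) * groundSol n ρ V e σ +
      pot V σ (e σ) * deriv (groundSol n ρ V e) σ) := by
  have h1 := hasDerivAt_groundSol hρ he hσ
  have h2 : HasDerivAt (fun σ => pot V σ (e σ)) (pot V 1 (deriv e σ)) σ := by
    have h := (hasDerivAt_ground hρ he hσ).differentiableAt.hasDerivAt
    exact HasDerivAt.sub ((hasDerivAt_id σ).smul_const V) (h.smul_const (1 : ℝ →ᵇ ℝ))
  have h3 : HasDerivAt (fun σ => 1 + volterra n ρ (pot V σ (e σ) * groundSol n ρ V e σ))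
      (volterra n ρ (pot V 1 (deriv e σ) * groundSol n ρ V e σ +
      pot V σ (e σ) * deriv (groundSol n ρ V e) σ)) σ :=
    ((volterra n ρ).hasFDerivAt.comp_hasDerivAt σ (h2.mul h1)).const_add 1
  have h4 : groundSol n ρ V e = fun σ => 1 + volterra n ρ (pot V σ (e σ) * groundSol n ρ V e σ) :=
    funext fun σ => radialSol_eq n ρ (pot V σ (e σ))
  exact (h3.congr_of_eventuallyEq (Eventually.of_forall fun x => congrFun h4 x)).deriv

/-- In the quotient rule, the relation e' ∫ u² rⁿ = ∫ V u² rⁿ combines the two terms and turns V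
into V - e'. -/
theorem hasDerivAt_deriv_ground (hρ : 0 < ρ) (he : ∀ σ, 0 < σ → IsGround n ρ V σ (e σ)) {σ : ℝ}
    (hσ : 0 < σ) :
    HasDerivAt (deriv e) (2 * radialInt n ρ (pot V 1 (deriv e σ) *
      (groundSol n ρ V e σ * deriv (groundSol n ρ V e) σ)) /
      radialInt n ρ (groundSol n ρ V e σ * groundSol n ρ V e σ)) σ := by
  have h1 := hasDerivAt_groundSol hρ he hσ
  have hpos := radialInt_groundSol_sq_pos hρ (he σ hσ)
  have hd : deriv e σ * radialInt n ρ (groundSol n ρ V e σ * groundSol n ρ V e σ) =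
      radialInt n ρ (V * (groundSol n ρ V e σ * groundSol n ρ V e σ)) := by
    rw [(hasDerivAt_ground hρ he hσ).deriv]
    field_simp
  set u := groundSol n ρ V e
  set v := deriv u σ
  have h2 : HasDerivAt (fun σ => radialInt n ρ (u σ * u σ)) (2 * radialInt n ρ (u σ * v)) σ := by
    refine ((radialInt n ρ).hasFDerivAt.comp_hasDerivAt σ (h1.mul h1)).congr_deriv ?_
    rw [mul_comm v, map_add, two_mul]
  have h3 : HasDerivAt (fun σ => radialInt n ρ (V * (u σ * u σ)))
      (2 * radialInt n ρ (V * (u σ * v))) σ := by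
    refine ((radialInt n ρ).hasFDerivAt.comp_hasDerivAt σ
      ((h1.mul h1).const_mul V)).congr_deriv ?_
    rw [mul_comm v, mul_add, map_add, two_mul]
  refine ((h3.div h2 hpos.ne').congr_deriv ?_).congr_of_eventuallyEq ?_
  · have h4 : radialInt n ρ (pot V 1 (deriv e σ) * (u σ * v)) =
        radialInt n ρ (V * (u σ * v)) - deriv e σ * radialInt n ρ (u σ * v) := by
      rw [pot, sub_mul, one_smul, map_sub, smul_mul_assoc, one_mul, map_smul, smul_eq_mul]
    rw [h4, ← hd]
    field_simp
  · filter_upwards [Ioi_mem_nhds hσ] with x hx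
    exact (hasDerivAt_ground hρ he hx).deriv

end GroundCurve

/-! ### Pohozaev identity and monotonicity of the logarithmic derivative -/

theorem eqOn_of_hasDerivAt_eq {f g f' : ℝ → ℝ} {ρ : ℝ} (hf : ContinuousOn f (Icc 0 ρ))
    (hg : ContinuousOn g (Icc 0 ρ)) (hf' : ∀ r ∈ Ioo 0 ρ, HasDerivAt f (f' r) r)
    (hg' : ∀ r ∈ Ioo 0 ρ, HasDerivAt g (f' r) r) (h0 : f 0 = g 0) {r : ℝ} (hr : r ∈ Icc 0 ρ) :
    f r = g r := by
  have h := intervalIntegral.integral_eq_sub_of_hasDerivAt_of_le (f := fun t => f t - g t)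
    (f' := fun _ => 0) hr.1 ((hf.sub hg).mono (Icc_subset_Icc_right hr.2)) (fun t ht => by
      have := (hf' t ⟨ht.1, ht.2.trans_le hr.2⟩).sub (hg' t ⟨ht.1, ht.2.trans_le hr.2⟩)
      rwa [sub_self] at this) intervalIntegrable_const
  simp only [intervalIntegral.integral_zero, h0, sub_self, sub_zero] at h
  linarith

theorem lt_of_strictMonoOn_of_tendsto {f : ℝ → ℝ} {a b l₁ l₂ : ℝ} (hab : a < b)
    (hf : StrictMonoOn f (Ioo a b)) (h₁ : Tendsto f (𝓝[>] a) (𝓝 l₁))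
    (h₂ : Tendsto f (𝓝[<] b) (𝓝 l₂)) : l₁ < l₂ := by
  obtain ⟨x, hax, hxb⟩ := exists_between hab
  obtain ⟨y, hxy, hyb⟩ := exists_between hxb
  have h3 : l₁ ≤ f x := by
    refine le_of_tendsto h₁ ?_
    filter_upwards [Ioo_mem_nhdsGT hax] with t ht
    exact (hf ⟨ht.1, ht.2.trans hxb⟩ ⟨hax, hxb⟩ ht.2).le
  have h4 : f y ≤ l₂ := by
    refine ge_of_tendsto h₂ ?_
    filter_upwards [Ioo_mem_nhdsLT hyb] with t ht
    exact (hf ⟨hax.trans hxy, hyb⟩ ⟨(hax.trans hxy).trans ht.1, ht.2⟩ ht.1).le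
  exact h3.trans_lt ((hf ⟨hax, hxb⟩ ⟨hax.trans hxy, hyb⟩ hxy).trans_le h4)

/-- A primitive, vanishing at `0`, of `f` on `(0, ρ)`. -/
structure IsPrimitive (ρ : ℝ) (F f : ℝ → ℝ) : Prop where
  continuousOn : ContinuousOn F (Icc 0 ρ)
  zero : F 0 = 0
  hasDerivAt : ∀ r ∈ Ioo 0 ρ, HasDerivAt F (f r) r

theorem IsPrimitive.pos {ρ : ℝ} {F f : ℝ → ℝ} (h : IsPrimitive ρ F f) {r : ℝ} (hr : r ∈ Ioc 0 ρ)
    (hf : ∀ t ∈ Ioo 0 r, 0 < f t) : 0 < F r := by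
  have hm : StrictMonoOn F (Icc 0 r) := by
    refine strictMonoOn_of_deriv_pos (convex_Icc 0 r)
      (h.1.mono (Icc_subset_Icc_right hr.2)) fun t ht => ?_
    rw [interior_Icc] at ht
    rw [(h.3 t ⟨ht.1, ht.2.trans_le hr.2⟩).deriv]
    exact hf t ht
  have h1 := hm (left_mem_Icc.2 hr.1.le) (right_mem_Icc.2 hr.1.le) hr.1
  rwa [h.zero] at h1

/-- A ground state `u` of energy `E` and coupling `σ` on `[0, ρ]` for the potential `r^{2s}`, its
variation `v` with respect to `σ`, where `E'` is the variation of the energy, and the primitives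
of `u² rⁿ`, `r^{2s} u² rⁿ` and `(r^{2s} - E') u v rⁿ`. -/
structure IsGroundVariation (n : ℕ) (ρ s σ E E' : ℝ) (u a v b M N L : ℝ → ℝ) : Prop where
  radius_pos : 0 < ρ
  exponent_pos : 0 < s
  coupling_pos : 0 < σ
  energy_pos : 0 < E
  sol : IsRadialPair n ρ u a (fun r => (σ * r ^ (2 * s) - E) * u r)
  var : IsRadialPair n ρ v b
    (fun r => (r ^ (2 * s) - E') * u r + (σ * r ^ (2 * s) - E) * v r)
  pos : ∀ r ∈ Ico 0 ρ, 0 < u r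
  zero : u ρ = 0
  slope_neg : a ρ < 0
  primM : IsPrimitive ρ M (fun r => u r ^ 2 * r ^ n)
  primN : IsPrimitive ρ N (fun r => r ^ (2 * s) * (u r ^ 2 * r ^ n))
  primL : IsPrimitive ρ L (fun r => (r ^ (2 * s) - E') * (u r * v r) * r ^ n)
  energy_deriv : N ρ = E' * M ρ

namespace IsGroundVariation

variable {n : ℕ} {ρ s σ E E' : ℝ} {u a v b M N L : ℝ → ℝ}

theorem continuous_rpow (h : IsGroundVariation n ρ s σ E E' u a v b M N L) :
    Continuous fun r : ℝ => r ^ (2 * s) :=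
  Real.continuous_rpow_const (by have := h.exponent_pos; positivity)

theorem hasDerivAt_rpow {r : ℝ} (hr : 0 < r) :
    HasDerivAt (fun r : ℝ => r ^ (2 * s)) (2 * s * r ^ (2 * s) / r) r := by
  refine (Real.hasDerivAt_rpow_const (Or.inl hr.ne')).congr_deriv ?_
  rw [Real.rpow_sub_one hr.ne']
  ring

theorem weight_pos (h : IsGroundVariation n ρ s σ E E' u a v b M N L) {r : ℝ}
    (hr : r ∈ Ioo 0 ρ) : 0 < u r ^ 2 * r ^ n :=
  mul_pos (pow_pos (h.pos r (Ioo_subset_Ico_self hr)) 2) (pow_pos hr.1 n)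

theorem M_pos (h : IsGroundVariation n ρ s σ E E' u a v b M N L) {r : ℝ} (hr : r ∈ Ioc 0 ρ) :
    0 < M r :=
  h.primM.pos hr fun _ ht => h.weight_pos ⟨ht.1, ht.2.trans_le hr.2⟩

theorem N_pos (h : IsGroundVariation n ρ s σ E E' u a v b M N L) {r : ℝ} (hr : r ∈ Ioc 0 ρ) :
    0 < N r :=
  h.primN.pos hr fun _ ht =>
    mul_pos (Real.rpow_pos_of_pos ht.1 _) (h.weight_pos ⟨ht.1, ht.2.trans_le hr.2⟩)

theorem N_lt (h : IsGroundVariation n ρ s σ E E' u a v b M N L) {r : ℝ} (hr : r ∈ Ioc 0 ρ) :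
    N r < r ^ (2 * s) * M r := by
  have hp : IsPrimitive ρ (fun t => r ^ (2 * s) * M t - N t)
      (fun t => (r ^ (2 * s) - t ^ (2 * s)) * (u t ^ 2 * t ^ n)) := by
    refine ⟨(continuousOn_const.mul h.primM.1).sub h.primN.1, by simp [h.primM.2, h.primN.2],
      fun t ht => ?_⟩
    refine (((h.primM.3 t ht).const_mul (r ^ (2 * s))).sub (h.primN.3 t ht)).congr_deriv ?_
    ring
  have h1 := hp.pos hr fun t ht => mul_pos (sub_pos.2 (Real.rpow_lt_rpow ht.1.le ht.2
    (by have := h.exponent_pos; positivity))) (h.weight_pos ⟨ht.1, ht.2.trans_le hr.2⟩)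
  linarith

/-- N - E' M vanishes at 0 and ρ, and its derivative has the sign of r^{2s} - E', which changes once
from negative to positive. -/
theorem N_le (h : IsGroundVariation n ρ s σ E E' u a v b M N L) {r : ℝ} (hr : r ∈ Ioc 0 ρ) :
    N r ≤ E' * M r := by
  rcases le_total (r ^ (2 * s)) E' with h1 | h1
  · exact (h.N_lt hr).le.trans (mul_le_mul_of_nonneg_right h1 (h.M_pos hr).le)
  · have hm : MonotoneOn (fun t => N t - E' * M t) (Icc r ρ) := by
      have hd : ∀ t ∈ Ioo r ρ, HasDerivAt (fun t => N t - E' * M t)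
          ((t ^ (2 * s) - E') * (u t ^ 2 * t ^ n)) t := by
        intro t ht
        have ht' : t ∈ Ioo 0 ρ := ⟨hr.1.trans ht.1, ht.2⟩
        refine ((h.primN.3 t ht').sub ((h.primM.3 t ht').const_mul E')).congr_deriv ?_
        ring
      refine monotoneOn_of_deriv_nonneg (convex_Icc r ρ)
        ((h.primN.1.sub (continuousOn_const.mul h.primM.1)).mono
          (Icc_subset_Icc_left hr.1.le)) ?_ ?_
      · rw [interior_Icc]
        exact fun t ht => (hd t ht).differentiableAt.differentiableWithinAt
      · rw [interior_Icc]
        intro t ht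
        rw [(hd t ht).deriv]
        refine mul_nonneg (sub_nonneg.2 (h1.trans ?_)) (h.weight_pos ⟨hr.1.trans ht.1, ht.2⟩).le
        exact Real.rpow_le_rpow hr.1.le ht.1.le (by have := h.exponent_pos; positivity)
    have h2 := hm (left_mem_Icc.2 hr.2) (right_mem_Icc.2 hr.2) hr.2
    simp only [h.energy_deriv, sub_self] at h2
    linarith

/-- The Pohozaev identity. -/
theorem pohozaev (h : IsGroundVariation n ρ s σ E E' u a v b M N L) {r : ℝ} (hr : r ∈ Icc 0 ρ) :
    2 * E * M r - (2 + 2 * s) * σ * N r = r ^ (n + 1) * (r ^ 2 * a r ^ 2 + (n - 1) * (u r * a r) +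
      (E - σ * r ^ (2 * s)) * u r ^ 2) := by
  have hV := h.continuous_rpow
  refine eqOn_of_hasDerivAt_eq (f := fun r => 2 * E * M r - (2 + 2 * s) * σ * N r)
    (g := fun r => r ^ (n + 1) * (r ^ 2 * a r ^ 2 + (n - 1) * (u r * a r) +
      (E - σ * r ^ (2 * s)) * u r ^ 2)) (f' := fun r => (2 * E - (2 + 2 * s) * σ * r ^ (2 * s)) *
      (u r ^ 2 * r ^ n)) ?_ ?_ (fun t ht => ?_) (fun t ht => ?_) ?_ hr
  · exact (continuousOn_const.mul h.primM.1).sub (continuousOn_const.mul h.primN.1)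
  · have h1 := h.sol.1
    have h2 := h.sol.2
    fun_prop
  · refine (((h.primM.3 t ht).const_mul (2 * E)).sub
      ((h.primN.3 t ht).const_mul ((2 + 2 * s) * σ))).congr_deriv ?_
    ring
  · have h1 : HasDerivAt (fun r : ℝ => r ^ (n + 1)) (((n : ℝ) + 1) * t ^ n) t := by
      simpa using hasDerivAt_pow (n + 1) t
    have hu := h.sol.3 t ht
    have ha := h.sol.4 t ht
    have hW := ((hasDerivAt_rpow (s := s) ht.1).const_mul σ).const_sub E
    refine (h1.mul ((((hasDerivAt_pow 2 t).mul (ha.pow 2)).add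
      ((hu.mul ha).const_mul ((n : ℝ) - 1))).add (hW.mul (hu.pow 2)))).congr_deriv ?_
    have ht0 : t ≠ 0 := ht.1.ne'
    simp only [Pi.add_apply, Pi.mul_apply, Pi.pow_apply]
    field_simp
    push_cast
    ring
  · simp [h.primM.2, h.primN.2]

/-- Divided by u² rⁿ, the left side is the derivative of v/u; this lets the variation be controlled
through M and N alone. -/
theorem wronskian_eq (h : IsGroundVariation n ρ s σ E E' u a v b M N L) {r : ℝ}
    (hr : r ∈ Icc 0 ρ) : r ^ (n + 1) * (b r * u r - v r * a r) = N r - E' * M r := by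
  refine eqOn_of_hasDerivAt_eq (f := wronskian n v b u a) (g := fun r => N r - E' * M r)
    (f' := fun r => (r ^ (2 * s) - E') * (u r ^ 2 * r ^ n)) (continuousOn_wronskian h.var h.sol)
    (h.primN.1.sub (continuousOn_const.mul h.primM.1)) (fun t ht => ?_) (fun t ht => ?_) ?_ hr
  · refine (hasDerivAt_wronskian h.var h.sol ht).congr_deriv ?_
    ring
  · refine ((h.primN.3 t ht).sub ((h.primM.3 t ht).const_mul E')).congr_deriv ?_
    ring
  · simp [h.primM.2, h.primN.2, wronskian_zero]

/-- The Pohozaev identity at ρ: since u(ρ) = 0, only the positive boundary term ρ^{n+3} a(ρ)²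
remains. In terms of p = σ E'/E this reads p < 1/(1+s). -/
theorem coupling_lt (h : IsGroundVariation n ρ s σ E E' u a v b M N L) :
    (2 + 2 * s) * (σ * E') < 2 * E := by
  have hρ := h.radius_pos
  have h1 := h.pohozaev (right_mem_Icc.2 hρ.le)
  rw [h.zero, h.energy_deriv] at h1
  have h2 : 0 < a ρ ^ 2 := sq_pos_iff.2 h.slope_neg.ne
  have h3 : 0 < (2 * E - (2 + 2 * s) * (σ * E')) * M ρ := by
    have h4 : 0 < ρ ^ (n + 1) * (ρ ^ 2 * a ρ ^ 2) := by positivity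
    nlinarith
  have := pos_of_mul_pos_left h3 (h.M_pos (right_mem_Ioc.2 hρ)).le
  linarith

theorem deriv_pos (h : IsGroundVariation n ρ s σ E E' u a v b M N L) : 0 < E' := by
  have h1 := h.N_pos (right_mem_Ioc.2 h.radius_pos)
  rw [h.energy_deriv] at h1
  exact pos_of_mul_pos_left h1 (h.M_pos (right_mem_Ioc.2 h.radius_pos)).le

theorem S_pos (h : IsGroundVariation n ρ s σ E E' u a v b M N L) {r : ℝ} (hr : r ∈ Ioc 0 ρ) :
    0 < 2 * E * M r - (2 + 2 * s) * σ * N r := by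
  have h1 := h.N_le hr
  have h2 := h.M_pos hr
  have h3 := h.coupling_lt
  have h4 : 0 < (2 + 2 * s) * σ := by have := h.exponent_pos; have := h.coupling_pos; positivity
  nlinarith [mul_le_mul_of_nonneg_left h1 h4.le, mul_pos (sub_pos.2 h3) h2]

end IsGroundVariation

namespace IsGroundVariation

variable {n : ℕ} {ρ s σ E E' : ℝ} {u a v b M N L : ℝ → ℝ}

/-- The quotient `h = R / S` with `R = p E M - σ N`, `S = 2 E M - (2 + 2 s) σ N`,
`p = σ E' / E`. -/
noncomputable def shift (s σ E E' : ℝ) (M N : ℝ → ℝ) (r : ℝ) : ℝ :=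
  (σ * E' * M r - σ * N r) / (2 * E * M r - (2 + 2 * s) * σ * N r)

theorem shift_mul (h : IsGroundVariation n ρ s σ E E' u a v b M N L) {r : ℝ} (hr : r ∈ Ioc 0 ρ) :
    shift s σ E E' M N r * (2 * E * M r - (2 + 2 * s) * σ * N r) = σ * E' * M r - σ * N r :=
  div_mul_cancel₀ _ (h.S_pos hr).ne'

theorem shift_nonneg (h : IsGroundVariation n ρ s σ E E' u a v b M N L) {r : ℝ}
    (hr : r ∈ Ioc 0 ρ) : 0 ≤ shift s σ E E' M N r := by
  refine div_nonneg ?_ (h.S_pos hr).le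
  have := mul_le_mul_of_nonneg_left (h.N_le hr) h.coupling_pos.le
  linarith

/-- With nonnegativity, this keeps the quotient bounded, so that the boundary terms in `corrector`
tend to 0 even though R and S both vanish at the centre. -/
theorem shift_le_one (h : IsGroundVariation n ρ s σ E E' u a v b M N L) {r : ℝ}
    (hr : r ∈ Ioc 0 ρ) : shift s σ E E' M N r ≤ 1 := by
  refine (div_le_one (h.S_pos hr)).2 ?_
  have h1 := h.coupling_lt
  have h2 := h.M_pos hr
  have h3 := h.N_le hr
  have h4 := h.coupling_pos
  have h5 := h.exponent_pos
  have h6 := h.N_pos hr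
  have h7 := mul_lt_mul_of_pos_right h1 h2
  have h8 : (1 + 2 * s) * σ * N r ≤ (1 + 2 * s) * σ * (E' * M r) :=
    mul_le_mul_of_nonneg_left h3 (by positivity)
  nlinarith

/-- With D = 2E - (2+2s)σE' > 0, multiplication by S gives (1 - (2+2s)q) S = D M and E (p - 2q) S =
D σ N. The claim thus reduces to (σN)² < σ r^{2s} M · E M, a product of the bounds N < r^{2s} M and
σN ≤ σE'M < E M. -/
theorem quad_pos (h : IsGroundVariation n ρ s σ E E' u a v b M N L) {r : ℝ} (hr : r ∈ Ioc 0 ρ) :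
    0 < σ * r ^ (2 * s) * (1 - (2 + 2 * s) * shift s σ E E' M N r) ^ 2 -
      E * (σ * E' / E - 2 * shift s σ E E' M N r) ^ 2 := by
  have hE := h.energy_pos
  have hσ := h.coupling_pos
  have hs := h.exponent_pos
  have hS := h.S_pos hr
  have hm := h.shift_mul hr
  have hM := h.M_pos hr
  have hN := h.N_pos hr
  have hc := h.coupling_lt
  set S := 2 * E * M r - (2 + 2 * s) * σ * N r with hSdef
  set q := shift s σ E E' M N r
  have h1 : (1 - (2 + 2 * s) * q) * S = (2 * E - (2 + 2 * s) * (σ * E')) * M r := by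
    rw [sub_mul, mul_assoc, hm, hSdef]
    ring
  have h2 : E * ((σ * E' / E - 2 * q) * S) = (2 * E - (2 + 2 * s) * (σ * E')) * (σ * N r) := by
    rw [sub_mul, mul_assoc 2, hm, hSdef]
    field_simp
    ring
  have h3 : σ * N r * (σ * N r) < σ * r ^ (2 * s) * M r * (E * M r) := by
    have h4 : σ * N r < σ * r ^ (2 * s) * M r := by
      rw [mul_assoc]
      exact mul_lt_mul_of_pos_left (h.N_lt hr) hσ
    have h5 : σ * N r < E * M r := by
      have h6 := mul_le_mul_of_nonneg_left (h.N_le hr) hσ.le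
      have h7 : σ * E' < E := by
        have := mul_pos hσ h.deriv_pos
        nlinarith
      nlinarith [mul_lt_mul_of_pos_right h7 hM]
    exact mul_lt_mul'' h4 h5 (by positivity) (by positivity)
  have hd : 0 < (2 * E - (2 + 2 * s) * (σ * E')) ^ 2 := by
    have : 0 < 2 * E - (2 + 2 * s) * (σ * E') := by linarith
    positivity
  have key : (σ * r ^ (2 * s) * (1 - (2 + 2 * s) * q) ^ 2 - E * (σ * E' / E - 2 * q) ^ 2) *
      (E * S ^ 2) = (2 * E - (2 + 2 * s) * (σ * E')) ^ 2 *
        (σ * r ^ (2 * s) * M r * (E * M r) - σ * N r * (σ * N r)) := by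
    have e1 : (σ * r ^ (2 * s) * (1 - (2 + 2 * s) * q) ^ 2 - E * (σ * E' / E - 2 * q) ^ 2) *
      (E * S ^ 2) = σ * r ^ (2 * s) * E * ((1 - (2 + 2 * s) * q) * S) ^ 2 -
        (E * ((σ * E' / E - 2 * q) * S)) ^ 2 := by ring
    rw [e1, h1, h2]
    ring
  have hpos : 0 < (σ * r ^ (2 * s) * (1 - (2 + 2 * s) * q) ^ 2 -
      E * (σ * E' / E - 2 * q) ^ 2) * (E * S ^ 2) := by
    rw [key]
    exact mul_pos hd (sub_pos.2 h3)
  exact pos_of_mul_pos_left hpos (by positivity)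

/-- The form `(2 h (p E - σ V) - h² (2 E - (2 + 2 s) σ V))`. -/
noncomputable def shiftForm (s σ E E' : ℝ) (M N : ℝ → ℝ) (r : ℝ) : ℝ :=
  2 * shift s σ E E' M N r * (σ * E' - σ * r ^ (2 * s)) -
    shift s σ E E' M N r ^ 2 * (2 * E - (2 + 2 * s) * σ * r ^ (2 * s))

/-- The quantity whose value at the boundary is (a multiple of) the derivative of `σ E' / E`. -/
noncomputable def variation (σ E E' : ℝ) (M N L : ℝ → ℝ) (r : ℝ) : ℝ :=
  σ * N r - (σ * E') ^ 2 / E * M r + 2 * σ ^ 2 * L r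

/-- Boundary terms by which `variation` differs from an increasing function. -/
noncomputable def corrector (n : ℕ) (s σ E E' : ℝ) (u a v M N : ℝ → ℝ) (r : ℝ) : ℝ :=
  2 * σ * ((σ * E' * M r - σ * N r) * (v r / u r)) +
    (-2 * (r ^ 2 * a r / u r) - (n - 1)) *
      (shift s σ E E' M N r * (σ * E' * M r - σ * N r)) +
    u r ^ 2 * r ^ (n + 1) * shiftForm s σ E E' M N r

/-- The relation is q' S = R' - q S', from R = q S. Keeping the factor S avoids explicit quotients
later. -/
theorem exists_hasDerivAt_shift (h : IsGroundVariation n ρ s σ E E' u a v b M N L) {r : ℝ}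
    (hr : r ∈ Ioo 0 ρ) : ∃ q', HasDerivAt (shift s σ E E' M N) q' r ∧
      q' * (2 * E * M r - (2 + 2 * s) * σ * N r) = u r ^ 2 * r ^ n *
        (σ * E' - σ * r ^ (2 * s) -
          shift s σ E E' M N r * (2 * E - (2 + 2 * s) * σ * r ^ (2 * s))) := by
  have hr' := Ioo_subset_Ioc_self hr
  have hS := (h.S_pos hr').ne'
  have hR := ((h.primM.3 r hr).const_mul (σ * E')).sub ((h.primN.3 r hr).const_mul σ)
  have hSd := ((h.primM.3 r hr).const_mul (2 * E)).sub
    ((h.primN.3 r hr).const_mul ((2 + 2 * s) * σ))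
  refine ⟨_, hR.div hSd hS, ?_⟩
  unfold shift
  simp only [Pi.sub_apply]
  generalize 2 * E * M r - (2 + 2 * s) * σ * N r = S at *
  field_simp

/-- Three cancellations. Adding 2σR v/u removes the indefinite 2σ²L' and leaves -2R²/X, by the
Wronskian formula for (v/u)'. With η = -2r²a/u - (n-1), Pohozaev gives η' = 2S/X, so the term η q R
contributes +2R²/X and η (qR)'. As (qR)' = X · `shiftForm`, the derivative of X r · `shiftForm`
removes η. The rest completes to squares. -/
theorem hasDerivAt_variation_add (h : IsGroundVariation n ρ s σ E E' u a v b M N L) {r : ℝ}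
    (hr : r ∈ Ioo 0 ρ) : ∃ q', HasDerivAt
      (fun r => variation σ E E' M N L r + corrector n s σ E E' u a v M N r)
      (u r ^ 2 * r ^ n * (σ * r ^ (2 * s) * (1 - (2 + 2 * s) * shift s σ E E' M N r) ^ 2 -
        E * (σ * E' / E - 2 * shift s σ E E' M N r) ^ 2) +
        2 * r * (2 * E * M r - (2 + 2 * s) * σ * N r) * q' ^ 2) r := by
  obtain ⟨q', hq, hqS⟩ := h.exists_hasDerivAt_shift hr
  have hr' := Ioo_subset_Ioc_self hr
  have hm := h.shift_mul hr'
  have hpo := h.pohozaev (Ioo_subset_Icc_self hr)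
  have hw := h.wronskian_eq (Ioo_subset_Icc_self hr)
  have hr0 : r ≠ 0 := hr.1.ne'
  have hu0 : u r ≠ 0 := (h.pos r (Ioo_subset_Ico_self hr)).ne'
  have hE0 := h.energy_pos.ne'
  have hX0 : u r ^ 2 * r ^ n ≠ 0 := (h.weight_pos hr).ne'
  have hM := h.primM.3 r hr
  have hN := h.primN.3 r hr
  have hL := h.primL.3 r hr
  have hu := h.sol.3 r hr
  have ha := h.sol.4 r hr
  have hv := h.var.3 r hr
  have hV := hasDerivAt_rpow (s := s) hr.1
  have hR := (hM.const_mul (σ * E')).sub (hN.const_mul σ)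
  have hvu : HasDerivAt (fun r => v r / u r)
      ((N r - E' * M r) / (u r ^ 2 * r ^ n)) r := by
    refine (hv.div hu hu0).congr_deriv ?_
    rw [← hw]
    field_simp
    ring
  -- A Riccati form of the equation: r²a/u is r times the logarithmic derivative of u, and the
  -- Pohozaev identity evaluates its derivative.
  have hy : HasDerivAt (fun r => -2 * (r ^ 2 * a r / u r) - ((n : ℝ) - 1))
      (2 * (2 * E * M r - (2 + 2 * s) * σ * N r) / (u r ^ 2 * r ^ n)) r := by
    refine ((((hasDerivAt_pow 2 r).mul ha).div hu hu0).const_mul (-2) |>.sub_const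
      ((n : ℝ) - 1)).congr_deriv ?_
    rw [hpo]
    simp only [Pi.mul_apply]
    field_simp
    push_cast
    ring
  have hX : HasDerivAt (fun r => u r ^ 2 * r ^ (n + 1))
      (u r ^ 2 * r ^ n * (2 - (-2 * (r ^ 2 * a r / u r) - ((n : ℝ) - 1)))) r := by
    refine ((hu.pow 2).mul (hasDerivAt_pow (n + 1) r)).congr_deriv ?_
    simp only [Pi.pow_apply, Nat.add_sub_cancel]
    push_cast
    field_simp
    ring
  have hF : HasDerivAt (shiftForm s σ E E' M N)
      (2 * q' * (σ * E' - σ * r ^ (2 * s) -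
          shift s σ E E' M N r * (2 * E - (2 + 2 * s) * σ * r ^ (2 * s))) +
        (-2 * shift s σ E E' M N r + (2 + 2 * s) * shift s σ E E' M N r ^ 2) *
          (σ * (2 * s * r ^ (2 * s) / r))) r := by
    refine (((hq.const_mul 2).mul ((hV.const_mul σ).const_sub (σ * E'))).sub
      ((hq.pow 2).mul ((hV.const_mul ((2 + 2 * s) * σ)).const_sub (2 * E)))).congr_deriv ?_
    simp only [Pi.pow_apply]
    push_cast
    ring
  refine ⟨q', ?_⟩
  have hall := (((hN.const_mul σ).sub (hM.const_mul ((σ * E') ^ 2 / E))).add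
    (hL.const_mul (2 * σ ^ 2))).add (((hR.mul hvu).const_mul (2 * σ)).add
      (hy.mul (hq.mul hR)) |>.add (hX.mul hF))
  refine hall.congr_deriv ?_
  simp only [Pi.sub_apply, Pi.mul_apply]
  have hfv : (r ^ (2 * s) - E') * (u r * v r) * r ^ n =
      (r ^ (2 * s) - E') * (u r ^ 2 * r ^ n) * (v r / u r) := by field_simp
  have hXr : u r ^ 2 * r ^ (n + 1) = u r ^ 2 * r ^ n * r := by ring
  have hform : shiftForm s σ E E' M N r =
    2 * shift s σ E E' M N r * (σ * E' - σ * r ^ (2 * s)) -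
    shift s σ E E' M N r ^ 2 * (2 * E - (2 + 2 * s) * σ * r ^ (2 * s)) := rfl
  rw [hfv, hXr, hform]
  generalize hSg : 2 * E * M r - (2 + 2 * s) * σ * N r = S at *
  have hRg : σ * E' * M r - σ * N r = shift s σ E E' M N r * S := hm.symm
  have hΓ : 2 * σ * ((σ * E' * M r - σ * N r) * ((N r - E' * M r) / (u r ^ 2 * r ^ n))) =
      -2 * (shift s σ E E' M N r * S) ^ 2 / (u r ^ 2 * r ^ n) := by
    rw [← hRg]
    field_simp
    ring
  rw [mul_add (2 * σ), hΓ, hRg]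
  generalize -2 * (r ^ 2 * a r / u r) - ((n : ℝ) - 1) = η
  generalize u r ^ 2 * r ^ n = X at *
  generalize v r / u r = f
  generalize r ^ (2 * s) = W at *
  generalize shift s σ E E' M N r = q at *
  have hri : r * r⁻¹ = 1 := mul_inv_cancel₀ hr0
  have hEi : E * E⁻¹ = 1 := mul_inv_cancel₀ hE0
  simp only [div_eq_mul_inv]
  -- The multiple η q of `hqS` cancels the terms in η; the multiple 2 r q' turns the derivative of
  -- `shiftForm` into 2 r S q'². The other two clear the inverses of r and E.
  linear_combination (η * q - 2 * r * q') * hqS +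
    (4 * σ * W * X * q ^ 2 * s * (1 + s) - 4 * σ * W * X * q * s) * hri +
    (σ ^ 2 * X * E' ^ 2 * E⁻¹ - 4 * σ * X * E' * q) * hEi

theorem strictMonoOn_variation_add (h : IsGroundVariation n ρ s σ E E' u a v b M N L) :
    StrictMonoOn (fun r => variation σ E E' M N L r + corrector n s σ E E' u a v M N r)
      (Ioo 0 ρ) := by
  choose! q' hq using fun r (hr : r ∈ Ioo 0 ρ) => h.hasDerivAt_variation_add hr
  refine strictMonoOn_of_deriv_pos (convex_Ioo 0 ρ)
    (fun r hr => (hq r hr).continuousAt.continuousWithinAt) fun r hr => ?_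
  rw [interior_Ioo] at hr
  rw [(hq r hr).deriv]
  have hr' := Ioo_subset_Ioc_self hr
  have h1 := mul_pos (h.weight_pos hr) (h.quad_pos hr')
  have h2 : 0 ≤ 2 * r * (2 * E * M r - (2 + 2 * s) * σ * N r) * q' r ^ 2 :=
    mul_nonneg (mul_nonneg (by linarith [hr.1]) (h.S_pos hr').le) (sq_nonneg _)
  linarith

/-- Stated for a filter so as to serve both ends. Each boundary term is a bounded factor times R,
R/u or u² r^{n+1}. -/
theorem tendsto_corrector (h : IsGroundVariation n ρ s σ E E' u a v b M N L) {l : Filter ℝ}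
    (hl : ∀ᶠ r in l, r ∈ Ioo 0 ρ)
    (hR : Tendsto (fun r => σ * E' * M r - σ * N r) l (𝓝 0))
    (hRu : Tendsto (fun r => (σ * E' * M r - σ * N r) / u r) l (𝓝 0))
    (hur : Tendsto (fun r => u r ^ 2 * r ^ (n + 1)) l (𝓝 0)) :
    Tendsto (corrector n s σ E E' u a v M N) l (𝓝 0) := by
  have hρ := h.radius_pos
  have hbound : ∀ {f : ℝ → ℝ}, ContinuousOn f (Icc 0 ρ) →
      ∃ C, ∀ r ∈ Icc 0 ρ, |f r| ≤ C := fun hf => by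
    obtain ⟨C, hC⟩ := isCompact_Icc.exists_bound_of_continuousOn hf
    exact ⟨C, fun r hr => hC r hr⟩
  have hbdd : ∀ {f g : ℝ → ℝ} (C : ℝ), (∀ᶠ r in l, |f r| ≤ C) → Tendsto g l (𝓝 0) →
      Tendsto (fun r => f r * g r) l (𝓝 0) := fun C hf hg =>
    bdd_le_mul_tendsto_zero' C hf hg
  obtain ⟨Cv, hCv⟩ := hbound h.var.1
  obtain ⟨Ca, hCa⟩ := hbound
    (((continuous_pow 2).continuousOn (s := Icc 0 ρ)).mul h.sol.2)
  have hV := h.continuous_rpow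
  obtain ⟨C1, hC1⟩ := hbound (f := fun r => σ * E' - σ * r ^ (2 * s))
    (Continuous.continuousOn (by fun_prop))
  obtain ⟨C2, hC2⟩ := hbound (f := fun r => 2 * E - (2 + 2 * s) * σ * r ^ (2 * s))
    (Continuous.continuousOn (by fun_prop))
  have hq : ∀ᶠ r in l, |shift s σ E E' M N r| ≤ 1 := by
    filter_upwards [hl] with r hr
    rw [abs_of_nonneg (h.shift_nonneg (Ioo_subset_Ioc_self hr))]
    exact h.shift_le_one (Ioo_subset_Ioc_self hr)
  have t1 := hbdd Cv (hl.mono fun r hr => hCv r (Ioo_subset_Icc_self hr)) hRu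
  have t2 := hbdd Ca (hl.mono fun r hr => hCa r (Ioo_subset_Icc_self hr)) hRu
  have t3 := hbdd 1 hq t2
  have t4 := hbdd 1 hq hR
  have t5 := hbdd 1 hq hur
  have t6 := hbdd C1 (hl.mono fun r hr => hC1 r (Ioo_subset_Icc_self hr)) t5
  have t7 := hbdd C2 (hl.mono fun r hr => hC2 r (Ioo_subset_Icc_self hr)) (hbdd 1 hq t5)
  have hall := ((((t1.const_mul (2 * σ)).add (t3.const_mul (-2))).sub
    (t4.const_mul ((n : ℝ) - 1))).add (t6.const_mul 2)).sub t7
  simp only [mul_zero, add_zero, sub_zero] at hall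
  refine hall.congr fun r => ?_
  unfold corrector shiftForm
  simp only [Pi.mul_apply]
  ring

theorem tendsto_Icc (h : IsGroundVariation n ρ s σ E E' u a v b M N L) {f : ℝ → ℝ}
    (hf : ContinuousOn f (Icc 0 ρ)) :
    Tendsto f (𝓝[>] 0) (𝓝 (f 0)) ∧ Tendsto f (𝓝[<] ρ) (𝓝 (f ρ)) := by
  have hρ := h.radius_pos
  constructor
  · rw [← nhdsWithin_Ioo_eq_nhdsGT hρ]
    exact (hf 0 (left_mem_Icc.2 hρ.le)).mono Ioo_subset_Icc_self
  · rw [← nhdsWithin_Ioo_eq_nhdsLT hρ]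
    exact (hf ρ (right_mem_Icc.2 hρ.le)).mono Ioo_subset_Icc_self

/-- R' contains u², whereas u' tends to ρ a(ρ) ≠ 0; by l'Hôpital's rule the simple zero of u is
harmless. -/
theorem tendsto_div_sol (h : IsGroundVariation n ρ s σ E E' u a v b M N L) :
    Tendsto (fun r => (σ * E' * M r - σ * N r) / u r) (𝓝[<] ρ) (𝓝 0) := by
  have hρ := h.radius_pos
  have hcR : ContinuousOn (fun r => σ * E' * M r - σ * N r) (Icc 0 ρ) :=
    (continuousOn_const.mul h.primM.1).sub (continuousOn_const.mul h.primN.1)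
  have hIoo : ∀ᶠ r in 𝓝[<] ρ, r ∈ Ioo 0 ρ := Ioo_mem_nhdsLT hρ
  have hra := (h.tendsto_Icc (continuousOn_id.mul h.sol.2)).2
  have hneg : ρ * a ρ < 0 := mul_neg_of_pos_of_neg hρ h.slope_neg
  refine HasDerivAt.lhopital_zero_nhdsLT (f' := fun r => σ * E' * (u r ^ 2 * r ^ n) -
    σ * (r ^ (2 * s) * (u r ^ 2 * r ^ n))) (g' := fun r => r * a r) ?_ ?_ ?_ ?_ ?_ ?_
  · filter_upwards [hIoo] with r hr
    exact ((h.primM.3 r hr).const_mul _).sub ((h.primN.3 r hr).const_mul _)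
  · filter_upwards [hIoo] with r hr
    exact h.sol.3 r hr
  · filter_upwards [hra.eventually_lt_const hneg] with r hr
    exact hr.ne
  · have h1 := (h.tendsto_Icc hcR).2
    have h2 : σ * E' * M ρ - σ * N ρ = 0 := by rw [h.energy_deriv]; ring
    rwa [h2] at h1
  · have h1 := (h.tendsto_Icc h.sol.1).2
    rwa [h.zero] at h1
  · have hV := h.continuous_rpow
    have hu := h.sol.1
    have h1 := (h.tendsto_Icc (f := fun r => σ * E' * (u r ^ 2 * r ^ n) -
      σ * (r ^ (2 * s) * (u r ^ 2 * r ^ n))) (by fun_prop)).2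
    have h2 := h1.div hra hneg.ne
    simpa [h.zero, Pi.div_def] using h2

theorem variation_pos (h : IsGroundVariation n ρ s σ E E' u a v b M N L) :
    0 < variation σ E E' M N L ρ := by
  have hρ := h.radius_pos
  have hu := h.sol.1
  have hcR : ContinuousOn (fun r => σ * E' * M r - σ * N r) (Icc 0 ρ) :=
    (continuousOn_const.mul h.primM.1).sub (continuousOn_const.mul h.primN.1)
  have hcu : ContinuousOn (fun r => u r ^ 2 * r ^ (n + 1)) (Icc 0 ρ) := by fun_prop
  have hcv : ContinuousOn (variation σ E E' M N L) (Icc 0 ρ) :=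
    ((continuousOn_const.mul h.primN.1).sub (continuousOn_const.mul h.primM.1)).add
      (continuousOn_const.mul h.primL.1)
  have hRρ : σ * E' * M ρ - σ * N ρ = 0 := by rw [h.energy_deriv]; ring
  have hR0 : σ * E' * M 0 - σ * N 0 = 0 := by rw [h.primM.2, h.primN.2]; ring
  have hR := h.tendsto_Icc hcR
  have hu2 := h.tendsto_Icc hcu
  simp only [hRρ, hR0, h.zero] at hR hu2
  have hu0 : u 0 ≠ 0 := (h.pos 0 (left_mem_Ico.2 hρ)).ne'
  have c0 := h.tendsto_corrector (l := 𝓝[>] 0) (Ioo_mem_nhdsGT hρ) hR.1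
    (by simpa [Pi.div_def] using hR.1.div (h.tendsto_Icc hu).1 hu0) (by simpa using hu2.1)
  have c1 := h.tendsto_corrector (l := 𝓝[<] ρ) (Ioo_mem_nhdsLT hρ) hR.2 h.tendsto_div_sol
    (by simpa using hu2.2)
  have hv := h.tendsto_Icc hcv
  have hv0 : variation σ E E' M N L 0 = 0 := by
    simp [variation, h.primM.2, h.primN.2, h.primL.2]
  have := lt_of_strictMonoOn_of_tendsto hρ h.strictMonoOn_variation_add (hv.1.add c0)
    (hv.2.add c1)
  simpa [hv0] using this

end IsGroundVariation

section GroundCurve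

variable {n : ℕ} {ρ s : ℝ} {V : ℝ →ᵇ ℝ} {e : ℝ → ℝ}

theorem isPrimitive_integral (n : ℕ) (ρ : ℝ) {f k : ℝ → ℝ} (hf : Continuous f)
    (hk : ∀ r ∈ Ioo 0 ρ, k r = f r * r ^ n) :
    IsPrimitive ρ (fun r => ∫ t in (0 : ℝ)..r, f t * t ^ n) k := by
  have hc : Continuous fun t : ℝ => f t * t ^ n := by fun_prop
  refine ⟨(intervalIntegral.continuous_primitive
    (fun a b => hc.intervalIntegrable a b) 0).continuousOn, by simp, fun r hr => ?_⟩
  rw [hk r hr]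
  exact hasDerivAt_integral_pow n hf r

theorem IsRadialPair.congr_source {g b k k' : ℝ → ℝ} (h : IsRadialPair n ρ g b k)
    (hk : ∀ r ∈ Ioo 0 ρ, k r = k' r) : IsRadialPair n ρ g b k' :=
  ⟨h.1, h.2, h.3, fun r hr => by rw [← hk r hr]; exact h.4 r hr⟩

theorem isGroundVariation (hρ : 0 < ρ) (hs : 0 < s) (hV : ∀ r ∈ Icc 0 ρ, V r = r ^ (2 * s))
    (he : ∀ σ, 0 < σ → IsGround n ρ V σ (e σ)) {σ : ℝ} (hσ : 0 < σ) :
    IsGroundVariation n ρ s σ (e σ) (deriv e σ) (groundSol n ρ V e σ)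
      (radialSlope n ρ (pot V σ (e σ))) (deriv (groundSol n ρ V e) σ : ℝ →ᵇ ℝ)
      (radialAvg n (pot V 1 (deriv e σ) * groundSol n ρ V e σ +
        pot V σ (e σ) * deriv (groundSol n ρ V e) σ : ℝ →ᵇ ℝ))
      (fun r => ∫ t in (0 : ℝ)..r, (groundSol n ρ V e σ * groundSol n ρ V e σ) t * t ^ n)
      (fun r => ∫ t in (0 : ℝ)..r, (V * (groundSol n ρ V e σ * groundSol n ρ V e σ)) t * t ^ n)
      (fun r => ∫ t in (0 : ℝ)..r, (pot V 1 (deriv e σ) *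
        (groundSol n ρ V e σ * deriv (groundSol n ρ V e) σ)) t * t ^ n) where
  radius_pos := hρ
  exponent_pos := hs
  coupling_pos := hσ
  energy_pos := (he σ hσ).energy_pos
  sol := (isRadialPair_radialSol n ρ (pot V σ (e σ))).congr_source fun r hr => by
    rw [pot_apply, hV r (Ioo_subset_Icc_self hr)]
    rfl
  var := by
    have h := isRadialPair_volterra n ρ (pot V 1 (deriv e σ) * groundSol n ρ V e σ +
      pot V σ (e σ) * deriv (groundSol n ρ V e) σ)
    rw [← deriv_groundSol_eq hρ he hσ] at h
    refine h.congr_source fun r hr => ?_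
    simp only [BoundedContinuousFunction.coe_add, BoundedContinuousFunction.coe_mul,
      Pi.add_apply, Pi.mul_apply, pot_apply, hV r (Ioo_subset_Icc_self hr), one_mul]
  pos := (he σ hσ).pos
  zero := (he σ hσ).zero
  slope_neg := (he σ hσ).slope_neg
  primM := isPrimitive_integral n ρ (BoundedContinuousFunction.continuous _) fun r hr => by
    rw [BoundedContinuousFunction.coe_mul, Pi.mul_apply, sq]
  primN := isPrimitive_integral n ρ (BoundedContinuousFunction.continuous _) fun r hr => by
    simp only [BoundedContinuousFunction.coe_mul, Pi.mul_apply, hV r (Ioo_subset_Icc_self hr)]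
    ring
  primL := isPrimitive_integral n ρ (BoundedContinuousFunction.continuous _) fun r hr => by
    simp only [BoundedContinuousFunction.coe_mul, Pi.mul_apply, pot_apply,
      hV r (Ioo_subset_Icc_self hr), one_mul]
  energy_deriv := by
    have h := (hasDerivAt_ground hρ he hσ).deriv
    have hpos := radialInt_groundSol_sq_pos hρ (he σ hσ)
    rw [eq_div_iff hpos.ne'] at h
    exact h.symm

/-- The logarithmic derivative `σ e'(σ) / e(σ)` of the energy is increasing. -/
theorem deriv_log_ground_pos (hρ : 0 < ρ) (hs : 0 < s) (hV : ∀ r ∈ Icc 0 ρ, V r = r ^ (2 * s))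
    (he : ∀ σ, 0 < σ → IsGround n ρ V σ (e σ)) {σ : ℝ} (hσ : 0 < σ) :
    0 < deriv e σ * e σ + σ * deriv (deriv e) σ * e σ - σ * deriv e σ ^ 2 := by
  have h := isGroundVariation hρ hs hV he hσ
  have hv := h.variation_pos
  have hE := h.energy_pos
  have hd := (hasDerivAt_deriv_ground hρ he hσ).deriv
  have hpos := radialInt_groundSol_sq_pos hρ (he σ hσ)
  have hed := h.energy_deriv
  simp only [IsGroundVariation.variation, ← radialInt_apply] at hv hed
  rw [eq_div_iff hpos.ne'] at hd
  set I := radialInt n ρ (groundSol n ρ V e σ * groundSol n ρ V e σ)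
  rw [hed] at hv
  -- At ρ, N = e' I and 2L = e'' I, so `variation` is the desired expression times σ I / e.
  have h2 : 0 < (deriv e σ * e σ + σ * deriv (deriv e) σ * e σ - σ * deriv e σ ^ 2) *
      (σ * I / e σ) := by
    refine hv.trans_eq ?_
    have h3 : 2 * σ ^ 2 * radialInt n ρ (pot V 1 (deriv e σ) *
        (groundSol n ρ V e σ * deriv (groundSol n ρ V e) σ)) =
        σ ^ 2 * (deriv (deriv e) σ * I) := by rw [hd]; ring
    rw [h3]
    field_simp
    ring
  exact pos_of_mul_pos_left h2 (by positivity)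

end GroundCurve

/-! ### Lower bounds for the energy -/

/-- A positive supersolution g at level lam bounds the energy from below: if E < lam, the Wronskian
of the ground state and g would be positive at ρ, where it equals ρ^{n+1} a(ρ) g(ρ) < 0. -/
theorem IsGround.le_energy {n : ℕ} {ρ : ℝ} (hρ : 0 < ρ) {V : ℝ →ᵇ ℝ} {σ E lam : ℝ}
    (h : IsGround n ρ V σ E) {g b k : ℝ → ℝ} (hg : IsRadialPair n ρ g b k)
    (hpos : ∀ r ∈ Ioc 0 ρ, 0 < g r)
    (hk : ∀ r ∈ Ioo 0 ρ, k r ≤ (σ * V r - lam) * g r) : lam ≤ E := by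
  by_contra hcon
  have hW := pos_of_wronskian_deriv_pos hρ (isRadialPair_radialSol n ρ (pot V σ E)) hg ?_
  · rw [h.zero, zero_mul, sub_zero] at hW
    exact absurd hW (mul_neg_of_neg_of_pos h.slope_neg (hpos ρ (right_mem_Ioc.2 hρ))).not_gt
  intro r hr
  have hu := h.pos r (Ioo_subset_Ico_self hr)
  have hg0 := hpos r (Ioo_subset_Ioc_self hr)
  rw [pot_apply]
  set U := radialSol n ρ (pot V σ E) r
  have h1 := mul_le_mul_of_nonneg_left (hk r hr) hu.le
  have h2 : 0 < (lam - E) * (U * g r) := mul_pos (by linarith) (mul_pos hu hg0)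
  linarith

theorem isRadialPair_rpow (n : ℕ) (ρ ε : ℝ) {r₀ : ℝ} (hr₀ : 0 < r₀) :
    IsRadialPair n ρ (fun r => (r₀ ^ 2 + r ^ 2) ^ (-(ε / 2)))
      (fun r => -ε * (r₀ ^ 2 + r ^ 2) ^ (-(ε / 2) - 1))
      (fun r => (ε * (ε + 2) * r ^ 2 / (r₀ ^ 2 + r ^ 2) ^ 2 - ε * (n + 1) / (r₀ ^ 2 + r ^ 2)) *
        (r₀ ^ 2 + r ^ 2) ^ (-(ε / 2))) := by
  have hD : ∀ r : ℝ, 0 < r₀ ^ 2 + r ^ 2 := fun r => by positivity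
  have hc : ∀ p : ℝ, Continuous fun r : ℝ => (r₀ ^ 2 + r ^ 2) ^ p := fun p =>
    Continuous.rpow_const (by fun_prop) fun r => Or.inl (hD r).ne'
  have hd : ∀ p r : ℝ, HasDerivAt (fun r : ℝ => (r₀ ^ 2 + r ^ 2) ^ p)
      (2 * r * p * (r₀ ^ 2 + r ^ 2) ^ (p - 1)) r := fun p r => by
    have h := ((hasDerivAt_pow 2 r).const_add (r₀ ^ 2)).rpow_const (p := p) (Or.inl (hD r).ne')
    refine h.congr_deriv ?_
    push_cast
    ring
  refine ⟨(hc _).continuousOn, (continuous_const.mul (hc _)).continuousOn, fun r hr => ?_,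
    fun r hr => ?_⟩
  · refine (hd _ r).congr_deriv ?_
    ring
  · refine ((hd _ r).const_mul (-ε)).congr_deriv ?_
    have h0 := (hD r).ne'
    have hr0 := hr.1.ne'
    rw [Real.rpow_sub_one h0, Real.rpow_sub_one h0]
    field_simp
    ring

/-- The supersolution (r₀² + r²)^{-ε/2} with ε = 4^{-s} ≤ 1. Its concavity gives the bound for r ≤
r₀/2; farther out the potential outweighs its convexity. The value of ε is (1/2)^{2s}, the loss in
r^{2s} on passing from r₀ to r₀/2. -/
theorem IsGround.le_energy_of_scale {n : ℕ} {ρ s : ℝ} (hρ : 0 < ρ) (hs : 0 < s) {V : ℝ →ᵇ ℝ}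
    {σ E r₀ : ℝ} (h : IsGround n ρ V σ E) (hr₀ : 0 < r₀)
    (hV : ∀ r ∈ Ioo 0 ρ, 0 ≤ σ * V r)
    (hr : ∀ r ∈ Ioo 0 ρ, r ^ 2 ≤ r₀ ^ 2 / 4 ∨ (4 : ℝ) ^ (-s) / r₀ ^ 2 ≤ σ * V r) :
    (4 : ℝ) ^ (-s) / (4 * r₀ ^ 2) ≤ E := by
  have hε0 : (0 : ℝ) < 4 ^ (-s) := Real.rpow_pos_of_pos (by norm_num) _
  have hε1 : (4 : ℝ) ^ (-s) ≤ 1 := Real.rpow_le_one_of_one_le_of_nonpos (by norm_num) (by linarith)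
  refine h.le_energy hρ (isRadialPair_rpow n ρ (4 ^ (-s)) hr₀)
    (fun r _ => Real.rpow_pos_of_pos (by positivity) _) fun r hr' => ?_
  have hV' := hV r hr'
  have hrr := hr r hr'
  generalize (4 : ℝ) ^ (-s) = ε at *
  generalize σ * V r = W at *
  have hp : 0 < (r₀ ^ 2 + r ^ 2) ^ (-(ε / 2)) := Real.rpow_pos_of_pos (by positivity) _
  refine mul_le_mul_of_nonneg_right ?_ hp.le
  have hA : 0 < r₀ ^ 2 := by positivity
  have hB : 0 < r ^ 2 := pow_pos hr'.1 2
  generalize r₀ ^ 2 = A at *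
  generalize r ^ 2 = B at *
  -- The dimension enters only through n + 1 ≥ 1.
  have hn : ε / (A + B) ≤ ε * (n + 1) / (A + B) := by
    gcongr
    nlinarith [(Nat.cast_nonneg n : (0 : ℝ) ≤ n)]
  suffices hmain : ε * (ε + 2) * B / (A + B) ^ 2 - ε / (A + B) ≤ W - ε / (4 * A) by linarith
  have hkey : ε * (ε + 2) * B / (A + B) ^ 2 - ε / (A + B) ≤ ε * (2 * B - A) / (A + B) ^ 2 := by
    have e1 : ε * (ε + 2) * B / (A + B) ^ 2 - ε / (A + B) =
        ε * ((ε + 1) * B - A) / (A + B) ^ 2 := by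
      field_simp
      ring
    rw [e1]
    gcongr
    linarith
  refine hkey.trans ?_
  rcases hrr with h1 | h1
  · have h2 : ε * (2 * B - A) / (A + B) ^ 2 ≤ -(ε / (4 * A)) := by
      rw [← neg_div, div_le_div_iff₀ (by positivity) (by positivity)]
      have h3 : (2 * B - A) * (4 * A) ≤ -(A + B) ^ 2 := by nlinarith
      nlinarith
    linarith
  · have h2 : ε * (2 * B - A) / (A + B) ^ 2 ≤ ε / (3 * A) := by
      rw [div_le_div_iff₀ (by positivity) (by positivity)]
      -- For fixed A, (2B - A)/(A + B)² is largest at B = 2A, with value 1/(3A).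
      have h3 : (2 * B - A) * (3 * A) ≤ (A + B) ^ 2 := by nlinarith [sq_nonneg (2 * A - B)]
      nlinarith
    have h3 : ε / (3 * A) + ε / (4 * A) ≤ ε / A := by
      rw [div_add_div _ _ (by positivity) (by positivity), div_le_div_iff₀ (by positivity) hA]
      have : 0 < ε * A ^ 2 := by positivity
      nlinarith [mul_pos this hA]
    linarith

theorem IsGround.const_le_energy {n : ℕ} {ρ s : ℝ} (hρ : 0 < ρ) (hs : 0 < s) {V : ℝ →ᵇ ℝ}
    (hV : ∀ r ∈ Icc 0 ρ, V r = r ^ (2 * s)) {σ E : ℝ} (hσ : 0 < σ) (h : IsGround n ρ V σ E) :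
    (4 : ℝ) ^ (-s) / (4 * (2 * ρ) ^ 2) ≤ E := by
  -- With r₀ = 2ρ the whole ball lies in the inner region, so the potential need only be
  -- nonnegative.
  refine h.le_energy_of_scale hρ hs (by positivity) (fun r hr => ?_) fun r hr => Or.inl ?_
  · rw [hV r (Ioo_subset_Icc_self hr)]
    exact mul_nonneg hσ.le (Real.rpow_nonneg hr.1.le _)
  · have := pow_le_pow_left₀ hr.1.le hr.2.le 2
    linarith

theorem IsGround.rpow_le_energy {n : ℕ} {ρ s : ℝ} (hρ : 0 < ρ) (hs : 0 < s) {V : ℝ →ᵇ ℝ}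
    (hV : ∀ r ∈ Icc 0 ρ, V r = r ^ (2 * s)) {σ E : ℝ} (hσ : 0 < σ) (h : IsGround n ρ V σ E) :
    (4 : ℝ) ^ (-s) / 4 * σ ^ (1 / (1 + s)) ≤ E := by
  -- The natural length of the operator, at which σ r₀^{2s} = r₀^{-2}.
  set r₀ := σ ^ (-(1 / (2 * (1 + s)))) with hr₀
  have hr₀' : 0 < r₀ := Real.rpow_pos_of_pos hσ _
  have h1s : 1 + s ≠ 0 := by positivity
  have e1 : (r₀ ^ 2)⁻¹ = σ ^ (1 / (1 + s)) := by
    rw [hr₀, ← Real.rpow_natCast, ← Real.rpow_mul hσ.le, ← Real.rpow_neg hσ.le]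
    congr 1
    push_cast
    field_simp
  have e2 : σ * r₀ ^ (2 * s) = (r₀ ^ 2)⁻¹ := by
    rw [e1, hr₀, ← Real.rpow_mul hσ.le]
    nth_rw 1 [← Real.rpow_one σ]
    rw [← Real.rpow_add hσ]
    congr 1
    field_simp
    ring
  have := h.le_energy_of_scale hρ hs hr₀' (fun r hr => ?_) fun r hr => ?_
  · rw [← e1]
    refine le_trans (le_of_eq ?_) this
    field_simp
  · rw [hV r (Ioo_subset_Icc_self hr)]
    exact mul_nonneg hσ.le (Real.rpow_nonneg hr.1.le _)
  · rw [hV r (Ioo_subset_Icc_self hr)]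
    rcases le_total r (r₀ / 2) with h1 | h1
    · left
      have := pow_le_pow_left₀ hr.1.le h1 2
      linarith
    · right
      have h2 : (r₀ / 2) ^ (2 * s) ≤ r ^ (2 * s) :=
        Real.rpow_le_rpow (by positivity) h1 (by positivity)
      have h3 : (r₀ / 2) ^ (2 * s) = 4 ^ (-s) * r₀ ^ (2 * s) := by
        rw [Real.div_rpow hr₀'.le (by norm_num), Real.rpow_mul (by norm_num : (0 : ℝ) ≤ 2),
          Real.rpow_neg (by norm_num)]
        norm_num
        ring
      calc (4 : ℝ) ^ (-s) / r₀ ^ 2 = σ * (4 ^ (-s) * r₀ ^ (2 * s)) := by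
            rw [mul_left_comm, e2]; ring
        _ ≤ σ * r ^ (2 * s) := by rw [← h3]; gcongr

/-! ### From the energy to F: coercivity, critical points, uniqueness -/

section Calculus

variable {e F : ℝ → ℝ} {α β c : ℝ}

theorem tendsto_rpow_mul_zero (hα : 0 < α) (hc : 0 < c) (he : ∀ σ, 0 < σ → c ≤ e σ)
    (hF : ∀ σ, 0 < σ → F σ = σ ^ (-α) * e σ) : Tendsto F (𝓝[>] 0) atTop := by
  have h := (tendsto_rpow_neg_nhdsGT_zero (y := -α) (by linarith)).atTop_mul_const hc
  refine tendsto_atTop_mono' _ ?_ h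
  filter_upwards [self_mem_nhdsWithin] with σ hσ
  rw [hF σ hσ]
  exact mul_le_mul_of_nonneg_left (he σ hσ) (Real.rpow_nonneg (le_of_lt hσ) _)

theorem tendsto_rpow_mul_atTop (hαβ : α < β) (hc : 0 < c) (he : ∀ σ, 0 < σ → c * σ ^ β ≤ e σ)
    (hF : ∀ σ, 0 < σ → F σ = σ ^ (-α) * e σ) : Tendsto F atTop atTop := by
  have h := (tendsto_rpow_atTop (sub_pos.2 hαβ)).const_mul_atTop hc
  refine tendsto_atTop_mono' _ ?_ h
  filter_upwards [Ioi_mem_atTop 0] with σ hσ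
  rw [hF σ hσ, sub_eq_neg_add, Real.rpow_add hσ, mul_left_comm]
  exact mul_le_mul_of_nonneg_left (he σ hσ) (Real.rpow_nonneg (le_of_lt hσ) _)

theorem exists_isMinOn_Ioi (hF : ContinuousOn F (Ioi 0)) (h0 : Tendsto F (𝓝[>] 0) atTop)
    (h1 : Tendsto F atTop atTop) : ∃ σ, 0 < σ ∧ IsMinOn F (Ioi 0) σ := by
  obtain ⟨a, ha, ha'⟩ := (mem_nhdsGT_iff_exists_Ioo_subset).1
    (h0.eventually_gt_atTop (F 1))
  obtain ⟨b, hb⟩ := (h1.eventually_gt_atTop (F 1)).exists_forall_of_atTop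
  have ha0 : 0 < a := ha
  have hsub : Icc (min a 1) (max b 1) ⊆ Ioi 0 := fun x hx =>
    (lt_min ha0 one_pos).trans_le hx.1
  have h1m : (1 : ℝ) ∈ Icc (min a 1) (max b 1) := ⟨min_le_right _ _, le_max_right _ _⟩
  obtain ⟨m, hm, hmin⟩ := isCompact_Icc.exists_isMinOn ⟨1, h1m⟩ (hF.mono hsub)
  refine ⟨m, hsub hm, fun x hx => ?_⟩
  have hm1 : F m ≤ F 1 := hmin h1m
  change F m ≤ F x
  by_cases hxa : x < min a 1
  · exact hm1.trans (le_of_lt (ha' ⟨hx, hxa.trans_le (min_le_left _ _)⟩))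
  · by_cases hxb : max b 1 < x
    · exact hm1.trans (le_of_lt (hb x ((le_max_left _ _).trans hxb.le)))
    · exact hmin ⟨not_lt.1 hxa, not_lt.1 hxb⟩

theorem hasDerivAt_of_contDiffOn_Ioi (he : ContDiffOn ℝ ∞ e (Ioi 0)) {σ : ℝ} (hσ : 0 < σ) :
    HasDerivAt e (deriv e σ) σ :=
  ((he.contDiffAt (Ioi_mem_nhds hσ)).differentiableAt (by simp)).hasDerivAt

theorem hasDerivAt_deriv_of_contDiffOn_Ioi (he : ContDiffOn ℝ ∞ e (Ioi 0)) {σ : ℝ} (hσ : 0 < σ) :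
    HasDerivAt (deriv e) (deriv (deriv e) σ) σ :=
  hasDerivAt_of_contDiffOn_Ioi (((contDiffOn_infty_iff_deriv_of_isOpen isOpen_Ioi).1 he).2) hσ

theorem contDiffOn_rpow_mul (he : ContDiffOn ℝ ∞ e (Ioi 0))
    (hF : ∀ σ, 0 < σ → F σ = σ ^ (-α) * e σ) : ContDiffOn ℝ ∞ F (Ioi 0) := by
  refine ContDiffOn.congr (ContDiffOn.mul (fun σ hσ => ?_) he) fun σ hσ => hF σ hσ
  exact (Real.contDiffAt_rpow_const_of_ne (ne_of_gt hσ)).contDiffWithinAt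

/-- The logarithmic derivative `σ e'(σ) / e(σ)`. -/
noncomputable def logSlope (e : ℝ → ℝ) (σ : ℝ) : ℝ := σ * deriv e σ / e σ

theorem hasDerivAt_rpow_mul (he : ContDiffOn ℝ ∞ e (Ioi 0)) (hpos : ∀ σ, 0 < σ → 0 < e σ)
    (hF : ∀ σ, 0 < σ → F σ = σ ^ (-α) * e σ) {σ : ℝ} (hσ : 0 < σ) :
    HasDerivAt F (σ ^ (-α - 1) * e σ * (logSlope e σ - α)) σ := by
  have h := (Real.hasDerivAt_rpow_const (p := -α) (Or.inl hσ.ne')).mul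
    (hasDerivAt_of_contDiffOn_Ioi he hσ)
  refine (h.congr_deriv ?_).congr_of_eventuallyEq ?_
  · have h1 := (hpos σ hσ).ne'
    rw [Real.rpow_sub_one hσ.ne', logSlope]
    field_simp
    ring
  · filter_upwards [Ioi_mem_nhds hσ] with x hx using hF x hx

theorem hasDerivAt_logSlope (he : ContDiffOn ℝ ∞ e (Ioi 0)) (hpos : ∀ σ, 0 < σ → 0 < e σ)
    {σ : ℝ} (hσ : 0 < σ) : HasDerivAt (logSlope e)
      ((deriv e σ * e σ + σ * deriv (deriv e) σ * e σ - σ * deriv e σ ^ 2) / e σ ^ 2) σ := by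
  have h := ((hasDerivAt_id σ).mul (hasDerivAt_deriv_of_contDiffOn_Ioi he hσ)).div
    (hasDerivAt_of_contDiffOn_Ioi he hσ) (hpos σ hσ).ne'
  refine h.congr_deriv ?_
  simp only [Pi.mul_apply, id]
  ring

theorem logSlope_eq_of_deriv_eq_zero (he : ContDiffOn ℝ ∞ e (Ioi 0))
    (hpos : ∀ σ, 0 < σ → 0 < e σ) (hF : ∀ σ, 0 < σ → F σ = σ ^ (-α) * e σ) {σ : ℝ} (hσ : 0 < σ)
    (h : deriv F σ = 0) : logSlope e σ = α := by
  rw [(hasDerivAt_rpow_mul he hpos hF hσ).deriv] at h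
  rcases mul_eq_zero.1 h with h | h
  · exact absurd h (mul_pos (Real.rpow_pos_of_pos hσ _) (hpos σ hσ)).ne'
  · linarith

/-- F' is a positive factor times p - α; where p = α, only the derivative of p survives in the
product rule. -/
theorem deriv_deriv_pos_of_deriv_eq_zero (he : ContDiffOn ℝ ∞ e (Ioi 0))
    (hpos : ∀ σ, 0 < σ → 0 < e σ)
    (hlog : ∀ σ, 0 < σ → 0 < deriv e σ * e σ + σ * deriv (deriv e) σ * e σ - σ * deriv e σ ^ 2)
    (hF : ∀ σ, 0 < σ → F σ = σ ^ (-α) * e σ) {σ : ℝ} (hσ : 0 < σ)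
    (h : deriv F σ = 0) : 0 < deriv (deriv F) σ := by
  have hp := logSlope_eq_of_deriv_eq_zero he hpos hF hσ h
  have h1 := ((Real.hasDerivAt_rpow_const (p := -α - 1) (Or.inl hσ.ne')).mul
    (hasDerivAt_of_contDiffOn_Ioi he hσ)).mul ((hasDerivAt_logSlope he hpos hσ).sub_const α)
  have h2 : deriv F =ᶠ[𝓝 σ] fun σ => σ ^ (-α - 1) * e σ * (logSlope e σ - α) := by
    filter_upwards [Ioi_mem_nhds hσ] with x hx using (hasDerivAt_rpow_mul he hpos hF hx).deriv
  rw [(h1.congr_of_eventuallyEq h2).deriv, hp, sub_self, mul_zero, zero_add]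
  exact mul_pos (mul_pos (Real.rpow_pos_of_pos hσ _) (hpos σ hσ))
    (div_pos (hlog σ hσ) (pow_pos (hpos σ hσ) 2))

theorem existsUnique_isMinOn_rpow_mul (he : ContDiffOn ℝ ∞ e (Ioi 0))
    (hpos : ∀ σ, 0 < σ → 0 < e σ)
    (hlog : ∀ σ, 0 < σ → 0 < deriv e σ * e σ + σ * deriv (deriv e) σ * e σ - σ * deriv e σ ^ 2)
    (hF : ∀ σ, 0 < σ → F σ = σ ^ (-α) * e σ) (h0 : Tendsto F (𝓝[>] 0) atTop)
    (h1 : Tendsto F atTop atTop) : ∃! σ, 0 < σ ∧ IsMinOn F (Ioi 0) σ := by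
  obtain ⟨m, hm, hmin⟩ := exists_isMinOn_Ioi (contDiffOn_rpow_mul he hF).continuousOn h0 h1
  have hcrit : ∀ σ, 0 < σ → IsMinOn F (Ioi 0) σ → logSlope e σ = α := fun σ hσ h =>
    logSlope_eq_of_deriv_eq_zero he hpos hF hσ (h.isLocalMin (Ioi_mem_nhds hσ)).deriv_eq_zero
  have hmono : StrictMonoOn (logSlope e) (Ioi 0) := by
    refine strictMonoOn_of_deriv_pos (convex_Ioi 0) (fun σ hσ =>
      (hasDerivAt_logSlope he hpos hσ).continuousAt.continuousWithinAt) fun σ hσ => ?_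
    rw [interior_Ioi] at hσ
    rw [(hasDerivAt_logSlope he hpos hσ).deriv]
    exact div_pos (hlog σ hσ) (pow_pos (hpos σ hσ) 2)
  refine ⟨m, ⟨hm, hmin⟩, fun y hy => ?_⟩
  exact hmono.injOn hy.1 hm ((hcrit y hy.1 hy.2).trans (hcrit m hm hmin).symm)

end Calculus

/-! ### Radial vector fields and the divergence theorem -/

theorem hasGradientAt_comp_norm_sq {m : ℕ} {f : ℝ → ℝ} {f' : ℝ} {x : Eu m}
    (hf : HasDerivAt f f' (‖x‖ ^ 2)) : HasGradientAt (fun y : Eu m => f (‖y‖ ^ 2)) ((2 * f') • x) x := by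
  rw [hasGradientAt_iff_hasFDerivAt]
  refine (hf.comp_hasFDerivAt x (hasStrictFDerivAt_norm_sq x).hasFDerivAt).congr_fderiv ?_
  ext y
  simp
  ring

/-- The partial derivative along the `i`-th axis of the `i`-th coordinate of the radial field
`x ↦ radialAvg n G ‖x‖ • x`. -/
noncomputable def fieldDeriv (n : ℕ) (G : ℝ → ℝ) (i : Fin (n + 1)) (x : Eu (n + 1)) : ℝ :=
  radialAvg n G ‖x‖ + (G ‖x‖ - (n + 1) * radialAvg n G ‖x‖) * (x i ^ 2 / ‖x‖ ^ 2)

theorem hasLineDerivAt_field (n : ℕ) {G : ℝ → ℝ} (hG : Continuous G) (i : Fin (n + 1))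
    (x : Eu (n + 1)) :
    HasLineDerivAt ℝ (fun y : Eu (n + 1) => radialAvg n G ‖y‖ * y i) (fieldDeriv n G i x) x
      (EuclideanSpace.single i 1) := by
  have ha := continuous_radialAvg n hG
  by_cases hx : x = 0
  · subst hx
    rw [hasLineDerivAt_iff_tendsto_slope_zero]
    -- At the origin the quotient x i² / ‖x‖² takes the value 0 / 0 = 0, which is the right one
    -- here.
    have h0 : fieldDeriv n G i 0 = radialAvg n G ‖(0 : ℝ)‖ := by simp [fieldDeriv]
    have hc : Continuous fun t : ℝ => radialAvg n G ‖t‖ := ha.comp continuous_norm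
    rw [h0]
    refine ((hc.tendsto 0).mono_left nhdsWithin_le_nhds).congr' ?_
    filter_upwards [self_mem_nhdsWithin] with t ht
    have ht' : t ≠ 0 := ht
    simp [norm_smul]
    field_simp
  · have hn : ‖x‖ ≠ 0 := norm_ne_zero_iff.2 hx
    have h1 : HasDerivAt (fun t : ℝ => x + t • (EuclideanSpace.single i (1 : ℝ) : Eu (n + 1)))
        (EuclideanSpace.single i 1) 0 := by
      simpa using ((hasDerivAt_id (0 : ℝ)).smul_const
        (EuclideanSpace.single i (1 : ℝ) : Eu (n + 1))).const_add x
    have h2 := h1.norm_sq.sqrt (by simpa using hn)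
    simp only [Real.sqrt_sq (norm_nonneg _), zero_smul, add_zero] at h2
    have h2' : HasDerivAt (fun t : ℝ => ‖x + t • (EuclideanSpace.single i (1 : ℝ) : Eu (n + 1))‖)
        (x i / ‖x‖) 0 := by
      refine h2.congr_deriv ?_
      rw [EuclideanSpace.inner_single_right]
      simp
      field_simp
    have h3 : HasDerivAt (radialAvg n G) ((G ‖x‖ - (n + 1) * radialAvg n G ‖x‖) / ‖x‖)
        ‖x + (0 : ℝ) • (EuclideanSpace.single i (1 : ℝ) : Eu (n + 1))‖ := by
      simpa using hasDerivAt_radialAvg n hG hn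
    have h4 : HasDerivAt (fun t : ℝ =>
        (x + t • (EuclideanSpace.single i (1 : ℝ) : Eu (n + 1))) i) 1 0 := by
      simpa using (hasDerivAt_id (0 : ℝ)).const_add (x i)
    have h5 := (h3.comp (0 : ℝ) h2').mul h4
    refine HasDerivAt.congr_deriv h5 ?_
    simp [fieldDeriv]
    field_simp
    ring

theorem sum_fieldDeriv (n : ℕ) (G : ℝ → ℝ) (x : Eu (n + 1)) :
    ∑ i, fieldDeriv n G i x = G ‖x‖ := by
  unfold fieldDeriv
  rw [Finset.sum_add_distrib, ← Finset.mul_sum, ← Finset.sum_div,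
    ← EuclideanSpace.real_norm_sq_eq]
  by_cases hx : x = 0
  · subst hx
    simp [radialAvg_zero]
    field_simp
  · have hn : ‖x‖ ≠ 0 := norm_ne_zero_iff.2 hx
    simp [div_self (pow_ne_zero 2 hn)]

theorem eq_zero_of_notMem_tsupport {m : ℕ} {θ : Eu m → ℝ} {g : Eu m → Eu m}
    (h : ∀ x, HasGradientAt θ (g x) x) {x : Eu m} (hx : x ∉ tsupport θ) : g x = 0 := by
  have h1 : θ =ᶠ[𝓝 x] fun _ => 0 := notMem_tsupport_iff_eventuallyEq.1 hx
  have h2 : HasGradientAt θ 0 x := (hasGradientAt_const x (0 : ℝ)).congr_of_eventuallyEq h1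
  exact (h x).unique h2

/-- The divergence theorem for the radial field `x ↦ radialAvg n G ‖x‖ • x`, whose divergence is
`G ‖x‖`. -/
theorem integral_field_eq_zero (n : ℕ) {G : ℝ → ℝ} (hG : Continuous G) {θ : Eu (n + 1) → ℝ}
    {g : Eu (n + 1) → Eu (n + 1)} (hθ : ∀ x, HasGradientAt θ (g x) x) (hg : Continuous g)
    (hs : HasCompactSupport θ) :
    ∫ x, (inner ℝ (g x) (radialAvg n G ‖x‖ • x) + θ x * G ‖x‖) = 0 := by
  have ha : Continuous fun x : Eu (n + 1) => radialAvg n G ‖x‖ :=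
    (continuous_radialAvg n hG).comp continuous_norm
  have hGc : Continuous fun x : Eu (n + 1) => G ‖x‖ := hG.comp continuous_norm
  have hθc : Continuous θ := continuous_iff_continuousAt.2 fun x => (hθ x).differentiableAt.continuousAt
  have hgs : HasCompactSupport g := HasCompactSupport.intro hs fun x hx =>
    eq_zero_of_notMem_tsupport hθ hx
  have hgi : ∀ i, Continuous fun x => g x i := fun i => (EuclideanSpace.proj i).continuous.comp hg
  have hxi : ∀ i, Continuous fun x : Eu (n + 1) => x i := fun i =>
    (EuclideanSpace.proj (𝕜 := ℝ) i).continuous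
  have hint : ∀ i, Integrable fun x => g x i * (radialAvg n G ‖x‖ * x i) := fun i => by
    refine Continuous.integrable_of_hasCompactSupport ((hgi i).mul (ha.mul (hxi i))) ?_
    exact HasCompactSupport.mul_right (hgs.comp_left (g := fun v : Eu (n + 1) => v i) rfl)
  -- The quotient is discontinuous at 0; boundedness and measurability suffice for integrability.
  have hq : ∀ i (x : Eu (n + 1)), ‖x i ^ 2 / ‖x‖ ^ 2‖ ≤ 1 := fun i x => by
    rw [Real.norm_of_nonneg (by positivity)]
    refine div_le_one_of_le₀ ?_ (by positivity)
    rw [← sq_abs]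
    exact pow_le_pow_left₀ (abs_nonneg _) (PiLp.norm_apply_le x i) 2
  have hint2 : ∀ i, Integrable fun x => θ x * fieldDeriv n G i x := fun i => by
    have h1 : Integrable fun x => θ x * radialAvg n G ‖x‖ :=
      Continuous.integrable_of_hasCompactSupport (hθc.mul ha) hs.mul_right
    have h2 : Integrable fun x => θ x * (G ‖x‖ - (n + 1) * radialAvg n G ‖x‖) :=
      Continuous.integrable_of_hasCompactSupport
        (hθc.mul (hGc.sub (continuous_const.mul ha))) hs.mul_right
    have h3 := h1.add (h2.mul_bdd (c := 1) (g := fun x => x i ^ 2 / ‖x‖ ^ 2)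
      (((hxi i).pow 2).measurable.div (continuous_norm.pow 2).measurable).aestronglyMeasurable
      (ae_of_all _ (hq i)))
    refine h3.congr (ae_of_all _ fun x => ?_)
    simp only [fieldDeriv, Pi.add_apply]
    ring
  have hparts : ∀ i, ∫ x, (θ x * fieldDeriv n G i x + g x i * (radialAvg n G ‖x‖ * x i)) = 0 :=
    fun i => by
    have h := integral_bilinear_hasLineDerivAt_right_eq_neg_left_of_integrable
      (μ := (volume : Measure (Eu (n + 1)))) (B := ContinuousLinearMap.mul ℝ ℝ) (f := θ)
      (f' := fun x => g x i) (g := fun x => radialAvg n G ‖x‖ * x i) (g' := fieldDeriv n G i)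
      (v := EuclideanSpace.single i 1) (hint i) (hint2 i)
      (Continuous.integrable_of_hasCompactSupport (hθc.mul (ha.mul (hxi i))) hs.mul_right)
      (fun x _ => by
        have h := (hasGradientAt_iff_hasFDerivAt.1 (hθ x)).hasLineDerivAt
          (EuclideanSpace.single i 1)
        simpa [EuclideanSpace.inner_single_right] using h)
      (fun x _ => hasLineDerivAt_field n hG i x)
    rw [integral_add (hint2 i) (hint i)]
    simp only [ContinuousLinearMap.mul_apply'] at h
    rw [h, neg_add_cancel]
  have hsum := Finset.sum_eq_zero (s := Finset.univ) (fun i _ => hparts i)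
  rw [← integral_finsetSum _ (fun i _ => by exact (hint2 i).add (hint i))] at hsum
  rw [← hsum]
  refine integral_congr_ae (ae_of_all _ fun x => ?_)
  simp only
  rw [Finset.sum_add_distrib, ← Finset.mul_sum, sum_fieldDeriv, add_comm]
  congr 1
  rw [PiLp.inner_apply]
  refine Finset.sum_congr rfl fun i _ => ?_
  simp
  ring

/-! ### The radial solution on the ball and Barta's inequality for test functions -/

/-- The profile with `radialSol n ρ w r = profile n ρ w (r ^ 2)`. -/
noncomputable def profile (n : ℕ) (ρ : ℝ) (w : ℝ →ᵇ ℝ) (t : ℝ) : ℝ :=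
  1 + ∫ q in (0 : ℝ)..t, radialSlope n ρ w (√q) / 2

theorem hasDerivAt_profile (n : ℕ) (ρ : ℝ) (w : ℝ →ᵇ ℝ) (t : ℝ) :
    HasDerivAt (profile n ρ w) (radialSlope n ρ w (√t) / 2) t := by
  have hc : Continuous fun q : ℝ => radialSlope n ρ w (√q) / 2 :=
    ((continuous_radialSlope n ρ w).comp Real.continuous_sqrt).div_const 2
  exact (intervalIntegral.integral_hasDerivAt_right (hc.intervalIntegrable 0 t)
    hc.stronglyMeasurable.stronglyMeasurableAtFilter hc.continuousAt).const_add 1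

theorem profile_sq (n : ℕ) {ρ : ℝ} (w : ℝ →ᵇ ℝ) {r : ℝ} (hr : r ∈ Icc 0 ρ) :
    profile n ρ w (r ^ 2) = radialSol n ρ w r := by
  have hd : ∀ r ∈ Ioo 0 ρ, HasDerivAt (fun r => profile n ρ w (r ^ 2))
      (r * radialSlope n ρ w r) r := fun r hr => by
    refine ((hasDerivAt_profile n ρ w (r ^ 2)).comp r (hasDerivAt_pow 2 r)).congr_deriv ?_
    rw [Real.sqrt_sq hr.1.le]
    push_cast
    ring
  have hcp : Continuous (profile n ρ w) :=
    continuous_iff_continuousAt.2 fun t => (hasDerivAt_profile n ρ w t).continuousAt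
  refine eqOn_of_hasDerivAt_eq (hcp.comp (continuous_pow 2)).continuousOn
    (radialSol n ρ w).continuous.continuousOn hd (isRadialPair_radialSol n ρ w).3 ?_ hr
  simp [profile, radialSol_zero]

/-- The radial solution as a function on `ℝ^{n+1}`. -/
noncomputable def ballSol (n : ℕ) (ρ : ℝ) (w : ℝ →ᵇ ℝ) (x : Eu (n + 1)) : ℝ :=
  profile n ρ w (‖x‖ ^ 2)

/-- The gradient of the radial solution. -/
noncomputable def ballGrad (n : ℕ) (ρ : ℝ) (w : ℝ →ᵇ ℝ) (x : Eu (n + 1)) : Eu (n + 1) :=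
  radialSlope n ρ w ‖x‖ • x

/-- Composing with the smooth function ‖x‖², instead of ‖x‖, makes the origin no exception. -/
theorem hasGradientAt_ballSol (n : ℕ) (ρ : ℝ) (w : ℝ →ᵇ ℝ) (x : Eu (n + 1)) :
    HasGradientAt (ballSol n ρ w) (ballGrad n ρ w x) x := by
  have h := hasGradientAt_comp_norm_sq (hasDerivAt_profile n ρ w (‖x‖ ^ 2))
  rw [Real.sqrt_sq (norm_nonneg x), mul_div_cancel₀ _ two_ne_zero] at h
  exact h

theorem continuous_ballSol (n : ℕ) (ρ : ℝ) (w : ℝ →ᵇ ℝ) : Continuous (ballSol n ρ w) :=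
  continuous_iff_continuousAt.2 fun x => (hasGradientAt_ballSol n ρ w x).differentiableAt.continuousAt

theorem continuous_ballGrad (n : ℕ) (ρ : ℝ) (w : ℝ →ᵇ ℝ) : Continuous (ballGrad n ρ w) :=
  ((continuous_radialSlope n ρ w).comp continuous_norm).smul continuous_id

theorem ballSol_eq (n : ℕ) {ρ : ℝ} (w : ℝ →ᵇ ℝ) {x : Eu (n + 1)} (hx : x ∈ Metric.ball 0 ρ) :
    ballSol n ρ w x = radialSol n ρ w ‖x‖ :=
  profile_sq n w ⟨norm_nonneg x, (mem_ball_zero_iff.1 hx).le⟩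

theorem setIntegral_ballGrad_eq_zero (n : ℕ) {ρ : ℝ} (w : ℝ →ᵇ ℝ) {θ : Eu (n + 1) → ℝ}
    {g : Eu (n + 1) → Eu (n + 1)} (hθ : ∀ x, HasGradientAt θ (g x) x) (hg : Continuous g)
    (hs : HasCompactSupport θ) (hsub : tsupport θ ⊆ Metric.ball 0 ρ) :
    ∫ x in Metric.ball 0 ρ, (inner ℝ (g x) (ballGrad n ρ w x) + w ‖x‖ * (ballSol n ρ w x * θ x))
      = 0 := by
  have h := integral_field_eq_zero n (w * radialSol n ρ w).continuous hθ hg hs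
  rw [← setIntegral_eq_integral_of_forall_compl_eq_zero (s := Metric.ball 0 ρ)] at h
  · rw [← h]
    refine setIntegral_congr_fun measurableSet_ball fun x hx => ?_
    simp only [ballSol_eq n w hx, BoundedContinuousFunction.coe_mul, Pi.mul_apply]
    rw [ballGrad, radialSlope]
    simp only [BoundedContinuousFunction.coe_mul]
    ring
  · intro x hx
    have hx' : x ∉ tsupport θ := fun h => hx (hsub h)
    rw [eq_zero_of_notMem_tsupport hθ hx', image_eq_zero_of_notMem_tsupport hx']
    simp

theorem IsTestFunction.hasGradientAt {m : ℕ} {Ω : Set (Eu m)} {φ : Eu m → ℝ}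
    (h : IsTestFunction Ω φ) (x : Eu m) : HasGradientAt φ (gradient φ x) x :=
  (h.1.differentiable (by simp) x).hasGradientAt

theorem IsTestFunction.continuous_gradient {m : ℕ} {Ω : Set (Eu m)} {φ : Eu m → ℝ}
    (h : IsTestFunction Ω φ) : Continuous (gradient φ) :=
  (InnerProductSpace.toDual ℝ (Eu m)).symm.continuous.comp (h.1.continuous_fderiv (by simp))

theorem IsTestFunction.hasCompactSupport_gradient {m : ℕ} {Ω : Set (Eu m)} {φ : Eu m → ℝ}
    (h : IsTestFunction Ω φ) : HasCompactSupport (gradient φ) :=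
  HasCompactSupport.intro h.2.1 fun _ hx => eq_zero_of_notMem_tsupport h.hasGradientAt hx

/-- Barta's inequality for test functions. -/
theorem barta_test (n : ℕ) {ρ : ℝ} {w : ℝ →ᵇ ℝ} (hpos : ∀ r ∈ Ico 0 ρ, 0 < radialSol n ρ w r)
    {φ : Eu (n + 1) → ℝ} (hφ : IsTestFunction (Metric.ball 0 ρ) φ) :
    0 ≤ ∫ x in Metric.ball 0 ρ,
      (inner ℝ (gradient φ x) (gradient φ x) + w ‖x‖ * (φ x * φ x)) := by
  set U := ballSol n ρ w
  set X := ballGrad n ρ w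
  have hU : ∀ x ∈ Metric.ball (0 : Eu (n + 1)) ρ, 0 < U x := fun x hx => by
    rw [show U x = _ from ballSol_eq n w hx]
    exact hpos _ ⟨norm_nonneg x, mem_ball_zero_iff.1 hx⟩
  -- The test function φ²/U in the weak equation of U. It is C¹ because U > 0 on the support of φ,
  -- and it is extended by 0.
  set θ : Eu (n + 1) → ℝ := fun x => φ x * (φ x / U x)
  set g : Eu (n + 1) → Eu (n + 1) := fun x =>
    (2 * (φ x / U x)) • gradient φ x - (φ x / U x) ^ 2 • X x
  have hUc := continuous_ballSol n ρ w
  have hXc := continuous_ballGrad n ρ w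
  have hφc := hφ.1.continuous
  have hgc := hφ.continuous_gradient
  have hzero : ∀ x ∉ tsupport φ, φ =ᶠ[𝓝 x] 0 := fun x hx => notMem_tsupport_iff_eventuallyEq.1 hx
  have hθ : ∀ x, HasGradientAt θ (g x) x := by
    intro x
    by_cases hx : x ∈ tsupport φ
    · have hU0 := (hU x (hφ.2.2 hx)).ne'
      have h1 := hasGradientAt_iff_hasFDerivAt.1 (hφ.hasGradientAt x)
      have h2 := hasGradientAt_iff_hasFDerivAt.1 (hasGradientAt_ballSol n ρ w x)
      rw [hasGradientAt_iff_hasFDerivAt]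
      refine (h1.mul (h1.mul (HasDerivAt.comp_hasFDerivAt x (hasDerivAt_inv hU0) h2))).congr_fderiv ?_
      ext y
      simp [g, U, X]
      field_simp
      ring
    · have h1 : θ =ᶠ[𝓝 x] fun _ => 0 := by
        filter_upwards [hzero x hx] with y hy
        simp [θ, hy]
      have h2 : g x = 0 := by simp [g, (hzero x hx).self_of_nhds]
      rw [h2]
      exact (hasGradientAt_const x (0 : ℝ)).congr_of_eventuallyEq h1
  have hg : Continuous g := by
    rw [continuous_iff_continuousAt]
    intro x
    by_cases hx : x ∈ tsupport φ
    · have hq : ContinuousAt (fun x => φ x / U x) x :=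
        hφc.continuousAt.div hUc.continuousAt (hU x (hφ.2.2 hx)).ne'
      exact ((continuousAt_const.mul hq).smul hgc.continuousAt).sub
        ((hq.pow 2).smul hXc.continuousAt)
    · refine (continuousAt_const (y := (0 : Eu (n + 1)))).congr ?_
      filter_upwards [hzero x hx] with y hy
      simp [g, hy]
  have hsub : tsupport θ ⊆ tsupport φ := closure_mono fun x hx hx0 => hx (by simp [θ, hx0])
  have hcs : HasCompactSupport θ := hφ.2.1.of_isClosed_subset (isClosed_tsupport θ) hsub
  have hθc : Continuous θ :=
    continuous_iff_continuousAt.2 fun x => (hθ x).differentiableAt.continuousAt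
  rw [← setIntegral_ballGrad_eq_zero n w hθ hg hcs (hsub.trans hφ.2.2)]
  have hwc : Continuous fun x : Eu (n + 1) => w ‖x‖ := w.continuous.comp continuous_norm
  refine setIntegral_mono_on ?_ ?_ measurableSet_ball fun x hx => ?_
  · refine (Continuous.integrable_of_hasCompactSupport ?_ ?_).integrableOn
    · exact (hg.inner hXc).add (hwc.mul (hUc.mul hθc))
    · refine HasCompactSupport.intro hcs fun x hx => ?_
      rw [eq_zero_of_notMem_tsupport hθ hx, image_eq_zero_of_notMem_tsupport hx]
      simp
  · refine (Continuous.integrable_of_hasCompactSupport ?_ ?_).integrableOn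
    · exact (hgc.inner hgc).add (hwc.mul (hφc.mul hφc))
    · refine HasCompactSupport.intro hφ.2.1 fun x hx => ?_
      rw [eq_zero_of_notMem_tsupport hφ.hasGradientAt hx, image_eq_zero_of_notMem_tsupport hx]
      simp
  · have hU0 := (hU x hx).ne'
    -- Picone's identity: |∇φ|² - ∇U · ∇(φ²/U) is the square of ∇φ - (φ/U) ∇U.
    have h1 : 0 ≤ inner ℝ (gradient φ x - (φ x / U x) • X x) (gradient φ x - (φ x / U x) • X x) :=
      real_inner_self_nonneg
    have h2 : U x * θ x = φ x * φ x := by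
      simp only [θ]
      field_simp
    rw [h2]
    simp only [inner_sub_left, inner_sub_right, real_inner_smul_left, real_inner_smul_right, g] at h1 ⊢
    rw [real_inner_comm (gradient φ x) (X x)] at *
    linarith

/-! ### Limits in L² and in H¹₀ -/

section L2

variable {α E : Type*} [MeasurableSpace α] {μ : Measure α} [NormedAddCommGroup E]

theorem tendsto_integral_inner [InnerProductSpace ℝ E] {f g : ℕ → α → E} {f₀ g₀ : α → E}
    (hf : ∀ k, MemLp (f k) 2 μ) (hg : ∀ k, MemLp (g k) 2 μ) (hf₀ : MemLp f₀ 2 μ)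
    (hg₀ : MemLp g₀ 2 μ) (hfl : Tendsto (fun k => eLpNorm (fun x => f k x - f₀ x) 2 μ) atTop (𝓝 0))
    (hgl : Tendsto (fun k => eLpNorm (fun x => g k x - g₀ x) 2 μ) atTop (𝓝 0)) :
    Tendsto (fun k => ∫ x, inner ℝ (f k x) (g k x) ∂μ) atTop (𝓝 (∫ x, inner ℝ (f₀ x) (g₀ x) ∂μ)) := by
  have h1 := (Lp.tendsto_Lp_iff_tendsto_eLpNorm'' f hf f₀ hf₀).2 hfl
  have h2 := (Lp.tendsto_Lp_iff_tendsto_eLpNorm'' g hg g₀ hg₀).2 hgl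
  have h3 := h1.inner (𝕜 := ℝ) h2
  have key : ∀ {a b : α → E} (ha : MemLp a 2 μ) (hb : MemLp b 2 μ),
      inner ℝ (ha.toLp a) (hb.toLp b) = ∫ x, inner ℝ (a x) (b x) ∂μ := fun ha hb => by
    rw [L2.inner_def]
    refine integral_congr_ae ?_
    filter_upwards [ha.coeFn_toLp, hb.coeFn_toLp] with x hx hy
    rw [hx, hy]
  simpa only [key] using h3

theorem integrable_inner_of_memLp [InnerProductSpace ℝ E] {f g : α → E} (hf : MemLp f 2 μ)
    (hg : MemLp g 2 μ) : Integrable (fun x => inner ℝ (f x) (g x)) μ := by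
  refine (L2.integrable_inner (𝕜 := ℝ) (hf.toLp f) (hg.toLp g)).congr ?_
  filter_upwards [hf.coeFn_toLp, hg.coeFn_toLp] with x hx hy
  rw [hx, hy]

theorem tendsto_eLpNorm_of_bounded [IsFiniteMeasure μ] {h : ℕ → α → E} (C : ℝ)
    (hm : ∀ k, AEStronglyMeasurable (h k) μ) (hb : ∀ k, ∀ᵐ x ∂μ, ‖h k x‖ ≤ C)
    (hl : ∀ᵐ x ∂μ, Tendsto (fun k => h k x) atTop (𝓝 0)) :
    Tendsto (fun k => eLpNorm (h k) 2 μ) atTop (𝓝 0) := by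
  have h1 : Tendsto (fun k => ∫⁻ x, ‖h k x‖ₑ ^ (2 : ℝ) ∂μ) atTop (𝓝 (∫⁻ _, 0 ∂μ)) := by
    refine tendsto_lintegral_of_dominated_convergence' (fun _ => ENNReal.ofReal C ^ (2 : ℝ))
      (fun k => (hm k).enorm.pow_const _) (fun k => ?_) ?_ ?_
    · filter_upwards [hb k] with x hx
      gcongr
      rw [← ofReal_norm]
      exact ENNReal.ofReal_le_ofReal hx
    · rw [lintegral_const]
      finiteness
    · filter_upwards [hl] with x hx
      have h2 := (ENNReal.continuous_rpow_const (y := 2)).tendsto _ |>.comp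
        ((continuous_enorm.tendsto (0 : E)).comp hx)
      simpa [Function.comp_def] using h2
  rw [lintegral_zero] at h1
  have h3 := (ENNReal.continuous_rpow_const (y := 1 / 2)).tendsto _ |>.comp h1
  simp only [eLpNorm_eq_lintegral_rpow_enorm_toReal (p := 2) two_ne_zero ENNReal.ofNat_ne_top]
  simpa [Function.comp_def] using h3

theorem tendsto_eLpNorm_mul {f : ℕ → α → ℝ} {f₀ w : α → ℝ} {C : ℝ} (hw : ∀ᵐ x ∂μ, |w x| ≤ C)
    (hl : Tendsto (fun k => eLpNorm (fun x => f k x - f₀ x) 2 μ) atTop (𝓝 0)) :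
    Tendsto (fun k => eLpNorm (fun x => w x * f k x - w x * f₀ x) 2 μ) atTop (𝓝 0) := by
  have h1 := ENNReal.Tendsto.const_mul (a := ENNReal.ofReal C) hl (Or.inr ENNReal.ofReal_ne_top)
  rw [mul_zero] at h1
  refine tendsto_of_tendsto_of_tendsto_of_le_of_le tendsto_const_nhds h1
    (fun _ => zero_le) fun k => ?_
  refine eLpNorm_le_mul_eLpNorm_of_ae_le_mul (f := fun x => w x * f k x - w x * f₀ x)
    (g := fun x => f k x - f₀ x) ?_ 2
  filter_upwards [hw] with x hx
  rw [← mul_sub, norm_mul]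
  exact mul_le_mul_of_nonneg_right hx (norm_nonneg _)

theorem tendsto_eLpNorm_const (f₀ : α → E) :
    Tendsto (fun _ : ℕ => eLpNorm (fun x => f₀ x - f₀ x) 2 μ) atTop (𝓝 0) := by
  simp

end L2

section Sobolev

variable {m : ℕ} {Ω : Set (Eu m)}

theorem IsTestFunction.memLp {φ : Eu m → ℝ} (h : IsTestFunction Ω φ) (μ : Measure (Eu m))
    [IsFiniteMeasureOnCompacts μ] : MemLp φ 2 μ :=
  h.1.continuous.memLp_of_hasCompactSupport h.2.1

theorem IsTestFunction.memLp_gradient {φ : Eu m → ℝ} (h : IsTestFunction Ω φ)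
    (μ : Measure (Eu m)) [IsFiniteMeasureOnCompacts μ] : MemLp (gradient φ) 2 μ :=
  h.continuous_gradient.memLp_of_hasCompactSupport h.hasCompactSupport_gradient

theorem integral_smul_gradient {φ ψ : Eu m → ℝ} (hφ : IsTestFunction Ω φ)
    (hψ : IsTestFunction Ω ψ) (c : Eu m) :
    ∫ x in Ω, φ x * inner ℝ c (gradient ψ x) = -∫ x in Ω, ψ x * inner ℝ c (gradient φ x) := by
  have hdφ : Continuous fun x => fderiv ℝ φ x c :=
    (hφ.1.continuous_fderiv (by simp)).clm_apply continuous_const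
  have hdψ : Continuous fun x => fderiv ℝ ψ x c :=
    (hψ.1.continuous_fderiv (by simp)).clm_apply continuous_const
  have h := integral_mul_fderiv_eq_neg_fderiv_mul_of_integrable
    (μ := (volume : Measure (Eu m))) (f := φ) (g := ψ) (v := c)
    ((hdφ.mul hψ.1.continuous).integrable_of_hasCompactSupport hψ.2.1.mul_left)
    ((hφ.1.continuous.mul hdψ).integrable_of_hasCompactSupport hφ.2.1.mul_right)
    ((hφ.1.continuous.mul hψ.1.continuous).integrable_of_hasCompactSupport hφ.2.1.mul_right)
    (fun x _ => hφ.1.differentiable (by simp) x) (fun x _ => hψ.1.differentiable (by simp) x)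
  have hgrad : ∀ (η : Eu m → ℝ) x, inner ℝ c (gradient η x) = fderiv ℝ η x c := fun η x => by
    rw [real_inner_comm, inner_gradient_left]
  have hz : ∀ {η : Eu m → ℝ}, IsTestFunction Ω η → ∀ x ∉ Ω, η x = 0 := fun hη x hx =>
    image_eq_zero_of_notMem_tsupport fun h => hx (hη.2.2 h)
  rw [setIntegral_eq_integral_of_forall_compl_eq_zero (fun x hx => by rw [hz hφ x hx, zero_mul]),
    setIntegral_eq_integral_of_forall_compl_eq_zero (fun x hx => by rw [hz hψ x hx, zero_mul])]
  simp only [hgrad]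
  rw [h]
  simp only [mul_comm]

/-- The weak gradient identity holds for test functions by parts and passes to the L² limit, tested
against each constant vector c. -/
theorem memH10_of_approx {u : Eu m → ℝ}
    {g : Eu m → Eu m}
    (hu : MemLp u 2 (volume.restrict Ω)) (hg : MemLp g 2 (volume.restrict Ω)) (φ : ℕ → Eu m → ℝ)
    (hφ : ∀ k, IsTestFunction Ω (φ k))
    (h1 : Tendsto (fun k => eLpNorm (fun x => φ k x - u x) 2 (volume.restrict Ω)) atTop (𝓝 0))
    (h2 : Tendsto (fun k => eLpNorm (fun x => gradient (φ k) x - g x) 2 (volume.restrict Ω))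
      atTop (𝓝 0)) : MemH10 Ω u g := by
  refine ⟨⟨hu, hg, fun ψ hψ => ?_⟩, φ, hφ, h1, h2⟩
  refine ext_inner_left ℝ fun c => ?_
  have hψ1 := hψ.memLp (volume.restrict Ω)
  have hψ2 := hψ.memLp_gradient (volume.restrict Ω)
  have i1 : Integrable (fun x => u x • gradient ψ x) (volume.restrict Ω) :=
    memLp_one_iff_integrable.1 (hψ2.smul hu)
  have i2 : Integrable (fun x => ψ x • g x) (volume.restrict Ω) :=
    memLp_one_iff_integrable.1 (hg.smul hψ1)
  rw [inner_neg_right, ← integral_inner i1, ← integral_inner i2]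
  simp only [inner_smul_right]
  have hψc : MemLp (fun x => inner ℝ c (gradient ψ x)) 2 (volume.restrict Ω) := hψ2.const_inner c
  have hψs : ∀ (h : Eu m → Eu m) x, ψ x * inner ℝ c (h x) = inner ℝ (ψ x • c) (h x) :=
    fun h x => by rw [real_inner_smul_left]
  have hψm : MemLp (fun x => ψ x • c) 2 (volume.restrict Ω) :=
    (hψ.1.continuous.smul continuous_const).memLp_of_hasCompactSupport hψ.2.1.smul_right
  have t1 := tendsto_integral_inner (fun k => (hφ k).memLp (volume.restrict Ω)) (fun _ => hψc) hu
    hψc h1 (tendsto_eLpNorm_const _)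
  have t2 := tendsto_integral_inner (fun _ => hψm)
    (fun k => (hφ k).memLp_gradient (volume.restrict Ω)) hψm hg (tendsto_eLpNorm_const _) h2
  have e : ∀ k, ∫ x in Ω, inner ℝ (φ k x) (inner ℝ c (gradient ψ x)) =
      -∫ x in Ω, inner ℝ (ψ x • c) (gradient (φ k) x) := fun k => by
    have h := integral_smul_gradient (hφ k) hψ c
    simp only [← hψs]
    rw [← h]
    refine integral_congr_ae (ae_of_all _ fun x => ?_)
    simp [mul_comm]
  simp only [e] at t1
  have h := tendsto_nhds_unique t1 t2.neg
  simp only [← hψs] at h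
  rw [← h]
  refine integral_congr_ae (ae_of_all _ fun x => ?_)
  simp [mul_comm]

end Sobolev

/-! ### The radial solution lies in H¹₀ -/

/-- A smooth `C¹`-approximation, vanishing near `T` and beyond, of a function on `[0, T]` that
vanishes at `T`. -/
theorem exists_smooth_approx {f f' : ℝ → ℝ} {T : ℝ} (hf' : Continuous f')
    (hf : ∀ t, HasDerivAt f (f' t) t) (hT : f T = 0) :
    ∃ (C : ℝ) (g g' : ℕ → ℝ → ℝ), (∀ k, ContDiff ℝ ∞ (g k)) ∧ (∀ k t, HasDerivAt (g k) (g' k t) t) ∧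
      (∀ k, ∃ S < T, ∀ t, S ≤ t → g k t = 0) ∧ (∀ k, ∀ t ∈ Ico 0 T, |g k t - f t| ≤ C) ∧
      (∀ k, ∀ t ∈ Ico 0 T, |g' k t - f' t| ≤ C) ∧
      (∀ t ∈ Ico 0 T, Tendsto (fun k => g k t - f t) atTop (𝓝 0)) ∧
      (∀ t ∈ Ico 0 T, Tendsto (fun k => g' k t - f' t) atTop (𝓝 0)) := by
  have hpoly : ∀ k : ℕ, ∃ p : Polynomial ℝ, ∀ x ∈ Icc 0 T, |p.eval x - f' x| < 1 / ((k : ℝ) + 1) :=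
    fun k => exists_polynomial_near_of_continuousOn 0 T f' hf'.continuousOn _ (by positivity)
  choose p hp using hpoly
  -- A cutoff that is 0 for T - t ≤ 1/(k+1) and 1 for T - t ≥ 2/(k+1). As f' need not vanish at T,
  -- the derivatives converge only pointwise on [0, T), with a uniform bound.
  set χ : ℕ → ℝ → ℝ := fun k t => Real.smoothTransition (((k : ℝ) + 1) * (T - t) - 1) with hχ
  set b : ℕ → ℝ → ℝ := fun k t => (p k).eval t * χ k t with hb
  obtain ⟨D, hD⟩ := isCompact_Icc.exists_bound_of_continuousOn (hf'.continuousOn (s := Icc 0 T))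
  have hbs : ∀ k, ContDiff ℝ ∞ (b k) := fun k => by
    refine ContDiff.mul (by simpa using (p k).contDiff_aeval (𝕜 := ℝ) ∞) (Real.smoothTransition.contDiff.comp ?_)
    exact (contDiff_const.mul (contDiff_const.sub contDiff_id)).sub contDiff_const
  have hbc : ∀ k, Continuous (b k) := fun k => (hbs k).continuous
  have hχ1 : ∀ k t, |χ k t| ≤ 1 := fun k t => by
    rw [abs_of_nonneg (Real.smoothTransition.nonneg _)]
    exact Real.smoothTransition.le_one _
  have hbb : ∀ k, ∀ t ∈ Icc 0 T, |b k t - f' t| ≤ 2 * D + 1 := by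
    intro k t ht
    have h1 : |(p k).eval t - f' t| ≤ 1 := (hp k t ht).le.trans
      (div_le_one_of_le₀ (by linarith [(Nat.cast_nonneg k : (0 : ℝ) ≤ k)]) (by positivity))
    have h2 : |f' t| ≤ D := hD t ht
    have h3 := hχ1 k t
    have e1 : b k t - f' t = ((p k).eval t - f' t) * χ k t + f' t * (χ k t - 1) := by
      simp only [hb]; ring
    have h4 : |χ k t - 1| ≤ 1 := by
      have := Real.smoothTransition.nonneg (((k : ℝ) + 1) * (T - t) - 1)
      have := Real.smoothTransition.le_one (((k : ℝ) + 1) * (T - t) - 1)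
      rw [abs_le]
      constructor <;> simp only [hχ] <;> linarith
    rw [e1]
    refine (abs_add_le _ _).trans ?_
    rw [abs_mul, abs_mul]
    have h5 : |(p k).eval t - f' t| * |χ k t| ≤ 1 * 1 := by gcongr
    have h6 : |f' t| * |χ k t - 1| ≤ D * 1 := by gcongr; exact (abs_nonneg _).trans h2
    have h7 : 0 ≤ D := (abs_nonneg _).trans h2
    linarith
  have hbl : ∀ t ∈ Ico 0 T, Tendsto (fun k => b k t - f' t) atTop (𝓝 0) := by
    intro t ht
    have h1 : Tendsto (fun k : ℕ => ((k : ℝ) + 1) * (T - t)) atTop atTop :=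
      (tendsto_natCast_atTop_atTop.atTop_add tendsto_const_nhds).atTop_mul_const (sub_pos.2 ht.2)
    refine squeeze_zero_norm' ?_ (tendsto_one_div_add_atTop_nhds_zero_nat (𝕜 := ℝ))
    filter_upwards [h1.eventually_ge_atTop 2] with k hk
    have h2 : χ k t = 1 := Real.smoothTransition.one_of_one_le (by linarith)
    simp only [hb, h2, mul_one]
    exact (hp k t (Ico_subset_Icc_self ht)).le
  have hfint : ∀ t, f t = ∫ q in T..t, f' q := fun t => by
    rw [intervalIntegral.integral_eq_sub_of_hasDerivAt (fun x _ => hf x)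
      (hf'.intervalIntegrable _ _), hT, sub_zero]
  have hsub : ∀ k t, (∫ q in T..t, b k q) - f t = ∫ q in T..t, (b k q - f' q) := fun k t => by
    rw [hfint, intervalIntegral.integral_sub ((hbc k).intervalIntegrable _ _)
      (hf'.intervalIntegrable _ _)]
  have hgd : ∀ k t, HasDerivAt (fun t => ∫ q in T..t, b k q) (b k t) t := fun k t =>
    intervalIntegral.integral_hasDerivAt_right ((hbc k).intervalIntegrable _ _)
      (hbc k).stronglyMeasurable.stronglyMeasurableAtFilter (hbc k).continuousAt
  -- Integrating from T rather than from 0 makes the approximants vanish near T and beyond.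
  refine ⟨max (2 * D + 1) ((2 * D + 1) * T), fun k t => ∫ q in T..t, b k q, b, fun k => ?_, hgd,
    fun k => ?_, fun k t ht => ?_, fun k t ht =>
      (hbb k t (Ico_subset_Icc_self ht)).trans (le_max_left _ _), fun t ht => ?_, hbl⟩
  · refine contDiff_infty_iff_deriv.2 ⟨fun t => (hgd k t).differentiableAt, ?_⟩
    rw [show deriv (fun t => ∫ q in T..t, b k q) = b k from funext fun t => (hgd k t).deriv]
    exact hbs k
  · have hk : (0 : ℝ) < (k : ℝ) + 1 := by positivity
    refine ⟨T - 1 / ((k : ℝ) + 1), by linarith [one_div_pos.2 hk], fun t ht => ?_⟩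
    change ∫ q in T..t, b k q = 0
    refine (intervalIntegral.integral_congr (g := fun _ => (0 : ℝ)) fun q hq => ?_).trans
      intervalIntegral.integral_zero
    have hq' : T - 1 / ((k : ℝ) + 1) ≤ q :=
      (le_min (by linarith [one_div_pos.2 hk]) ht).trans hq.1
    have h1 : ((k : ℝ) + 1) * (T - q) ≤ 1 := by
      have h2 : T - q ≤ 1 / ((k : ℝ) + 1) := by linarith
      calc ((k : ℝ) + 1) * (T - q) ≤ ((k : ℝ) + 1) * (1 / ((k : ℝ) + 1)) := by gcongr
        _ = 1 := by field_simp
    have h3 : χ k q = 0 := Real.smoothTransition.zero_of_nonpos (by linarith)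
    simp [hb, h3]
  · simp only
    rw [hsub]
    have h1 := intervalIntegral.norm_integral_le_of_norm_le_const (a := T) (b := t)
      (C := 2 * D + 1) (f := fun q => b k q - f' q) (fun q hq => by
        rw [uIoc_of_ge ht.2.le] at hq
        exact hbb k q ⟨ht.1.trans hq.1.le, hq.2⟩)
    refine (h1.trans ?_).trans (le_max_right _ _)
    have hD0 : 0 ≤ 2 * D + 1 :=
      (abs_nonneg _).trans (hbb k t (Ico_subset_Icc_self ht))
    refine mul_le_mul_of_nonneg_left ?_ hD0
    rw [abs_sub_comm, abs_of_pos (sub_pos.2 ht.2)]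
    linarith [ht.1]
  · simp only [hsub]
    have h1 := intervalIntegral.tendsto_integral_filter_of_dominated_convergence (μ := volume)
      (a := T) (b := t) (l := atTop) (F := fun (k : ℕ) q => b k q - f' q) (f := fun _ => 0)
      (fun _ => 2 * D + 1)
      (Eventually.of_forall fun k => ((hbc k).sub hf').aestronglyMeasurable)
      (Eventually.of_forall fun k => ae_of_all _ fun q hq => by
        rw [uIoc_of_ge ht.2.le] at hq
        exact hbb k q ⟨ht.1.trans hq.1.le, hq.2⟩)
      intervalIntegrable_const ?_
    · simpa using h1
    · filter_upwards [show ∀ᵐ q : ℝ, q ≠ T from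
        (measure_eq_zero_iff_ae_notMem.1 (measure_singleton T))] with q hq hm
      rw [uIoc_of_ge ht.2.le] at hm
      exact hbl q ⟨ht.1.trans hm.1.le, lt_of_le_of_ne hm.2 hq⟩

theorem norm_sq_mem_Ico {m : ℕ} {ρ : ℝ} {x : Eu m} (hx : x ∈ Metric.ball 0 ρ) :
    ‖x‖ ^ 2 ∈ Ico 0 (ρ ^ 2) :=
  ⟨by positivity, pow_lt_pow_left₀ (mem_ball_zero_iff.1 hx) (norm_nonneg x) two_ne_zero⟩

theorem memLp_ball_of_continuous {m : ℕ} {E : Type*} [NormedAddCommGroup E] {ρ : ℝ}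
    {f : Eu m → E} (hf : Continuous f) : MemLp f 2 (volume.restrict (Metric.ball 0 ρ)) := by
  have : IsFiniteMeasure (volume.restrict (Metric.ball (0 : Eu m) ρ)) :=
    ⟨by rw [Measure.restrict_apply_univ]; exact measure_ball_lt_top⟩
  obtain ⟨C, hC⟩ := (isCompact_closedBall (0 : Eu m) ρ).exists_bound_of_continuousOn hf.continuousOn
  exact MemLp.of_bound hf.aestronglyMeasurable C ((ae_restrict_iff' measurableSet_ball).2
    (ae_of_all _ fun x hx => hC x (Metric.ball_subset_closedBall hx)))

/-- The zero of the profile at ρ² lets it be approximated by smooth profiles supported away from the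
boundary; bounded pointwise convergence on the ball gives L² convergence of values and gradients. -/
theorem memH10_ballSol (n : ℕ) {ρ : ℝ} (hρ : 0 < ρ) {w : ℝ →ᵇ ℝ} (h0 : radialSol n ρ w ρ = 0) :
    MemH10 (Metric.ball 0 ρ) (ballSol n ρ w) (ballGrad n ρ w) := by
  have hfin : IsFiniteMeasure (volume.restrict (Metric.ball (0 : Eu (n + 1)) ρ)) :=
    ⟨by rw [Measure.restrict_apply_univ]; exact measure_ball_lt_top⟩
  have hc : Continuous fun t : ℝ => radialSlope n ρ w (√t) / 2 :=
    ((continuous_radialSlope n ρ w).comp Real.continuous_sqrt).div_const 2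
  have hT : profile n ρ w (ρ ^ 2) = 0 := by
    rw [profile_sq n w (right_mem_Icc.2 hρ.le), h0]
  obtain ⟨C, g, g', hgs, hgd, hg0, hgC, hgC', hgl, hgl'⟩ :=
    exists_smooth_approx hc (hasDerivAt_profile n ρ w) hT
  have htest : ∀ k, IsTestFunction (Metric.ball (0 : Eu (n + 1)) ρ) (fun x => g k (‖x‖ ^ 2)) := by
    intro k
    obtain ⟨S, hS, hS0⟩ := hg0 k
    have hcl : IsClosed {x : Eu (n + 1) | ‖x‖ ^ 2 ≤ S} :=
      isClosed_le (by fun_prop) continuous_const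
    have hsupp : tsupport (fun x : Eu (n + 1) => g k (‖x‖ ^ 2)) ⊆ {x | ‖x‖ ^ 2 ≤ S} := by
      refine closure_minimal (fun x hx => ?_) hcl
      by_contra hcon
      exact hx (hS0 _ (not_le.1 hcon).le)
    have hball : {x : Eu (n + 1) | ‖x‖ ^ 2 ≤ S} ⊆ Metric.ball 0 ρ := fun x hx => by
      rw [mem_ball_zero_iff]
      exact lt_of_pow_lt_pow_left₀ 2 hρ.le (lt_of_le_of_lt hx hS)
    refine ⟨(hgs k).comp (contDiff_norm_sq ℝ), ?_, hsupp.trans hball⟩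
    exact (isCompact_closedBall (0 : Eu (n + 1)) ρ).of_isClosed_subset (isClosed_tsupport _)
      ((hsupp.trans hball).trans Metric.ball_subset_closedBall)
  have hgrad : ∀ k x, gradient (fun x : Eu (n + 1) => g k (‖x‖ ^ 2)) x =
      (2 * g' k (‖x‖ ^ 2)) • x := fun k x =>
    (hasGradientAt_comp_norm_sq (hgd k (‖x‖ ^ 2))).gradient
  have hX : ∀ x : Eu (n + 1), ballGrad n ρ w x =
      (2 * (radialSlope n ρ w (√(‖x‖ ^ 2)) / 2)) • x := fun x => by
    rw [Real.sqrt_sq (norm_nonneg x), mul_div_cancel₀ _ two_ne_zero]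
    rfl
  have hball : ∀ {P : Eu (n + 1) → Prop}, (∀ x ∈ Metric.ball (0 : Eu (n + 1)) ρ, P x) →
      ∀ᵐ x ∂(volume.restrict (Metric.ball (0 : Eu (n + 1)) ρ)), P x := fun h =>
    (ae_restrict_iff' measurableSet_ball).2 (ae_of_all _ h)
  refine memH10_of_approx (memLp_ball_of_continuous (continuous_ballSol n ρ w))
    (memLp_ball_of_continuous (continuous_ballGrad n ρ w)) (fun k x => g k (‖x‖ ^ 2)) htest ?_ ?_
  · refine tendsto_eLpNorm_of_bounded C (fun k => ?_) (fun k => hball fun x hx => ?_)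
      (hball fun x hx => ?_)
    · exact ((htest k).1.continuous.sub (continuous_ballSol n ρ w)).aestronglyMeasurable
    · exact hgC k _ (norm_sq_mem_Ico hx)
    · exact hgl _ (norm_sq_mem_Ico hx)
  · have hd : ∀ k (x : Eu (n + 1)), gradient (fun x : Eu (n + 1) => g k (‖x‖ ^ 2)) x -
        ballGrad n ρ w x =
        (2 * (g' k (‖x‖ ^ 2) - radialSlope n ρ w (√(‖x‖ ^ 2)) / 2)) • x := fun k x => by
      rw [hgrad, hX, ← sub_smul, mul_sub]
    refine tendsto_eLpNorm_of_bounded (2 * C * ρ) (fun k => ?_) (fun k => hball fun x hx => ?_)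
      (hball fun x hx => ?_)
    · exact ((htest k).continuous_gradient.sub (continuous_ballGrad n ρ w)).aestronglyMeasurable
    · rw [hd, norm_smul, norm_mul, Real.norm_two]
      have h1 := hgC' k _ (norm_sq_mem_Ico hx)
      have h2 := (mem_ball_zero_iff.1 hx).le
      rw [← Real.norm_eq_abs] at h1
      have h3 := (norm_nonneg _).trans h1
      gcongr
    · simp only [hd]
      have h1 := ((hgl' _ (norm_sq_mem_Ico hx)).const_mul 2).smul_const x
      simpa using h1

/-! ### The ground energy is the first Dirichlet eigenvalue -/

section Eigenvalue

variable {n : ℕ} {ρ : ℝ} {w : ℝ →ᵇ ℝ}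

theorem memLp_mul_norm (w : ℝ →ᵇ ℝ) {v : Eu (n + 1) → ℝ} {μ : Measure (Eu (n + 1))}
    (hv : MemLp v 2 μ) : MemLp (fun x => w ‖x‖ * v x) 2 μ := by
  have hw : Continuous fun x : Eu (n + 1) => w ‖x‖ := w.continuous.comp continuous_norm
  refine hv.of_le_mul (c := ‖w‖) (hw.aestronglyMeasurable.mul hv.1) (ae_of_all _ fun x => ?_)
  rw [norm_mul]
  exact mul_le_mul_of_nonneg_right (w.norm_coe_le_norm _) (norm_nonneg _)

theorem integral_form_tendsto {μ : Measure (Eu (n + 1))} (w : ℝ →ᵇ ℝ)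
    {u v : ℕ → Eu (n + 1) → ℝ} {u₀ v₀ : Eu (n + 1) → ℝ} {f g : ℕ → Eu (n + 1) → Eu (n + 1)}
    {f₀ g₀ : Eu (n + 1) → Eu (n + 1)} (hu : ∀ k, MemLp (u k) 2 μ) (hv : ∀ k, MemLp (v k) 2 μ)
    (hf : ∀ k, MemLp (f k) 2 μ) (hg : ∀ k, MemLp (g k) 2 μ) (hu₀ : MemLp u₀ 2 μ)
    (hv₀ : MemLp v₀ 2 μ) (hf₀ : MemLp f₀ 2 μ) (hg₀ : MemLp g₀ 2 μ)
    (hul : Tendsto (fun k => eLpNorm (fun x => u k x - u₀ x) 2 μ) atTop (𝓝 0))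
    (hvl : Tendsto (fun k => eLpNorm (fun x => v k x - v₀ x) 2 μ) atTop (𝓝 0))
    (hfl : Tendsto (fun k => eLpNorm (fun x => f k x - f₀ x) 2 μ) atTop (𝓝 0))
    (hgl : Tendsto (fun k => eLpNorm (fun x => g k x - g₀ x) 2 μ) atTop (𝓝 0)) :
    Tendsto (fun k => ∫ x, (inner ℝ (g k x) (f k x) + w ‖x‖ * (u k x * v k x)) ∂μ) atTop
      (𝓝 (∫ x, (inner ℝ (g₀ x) (f₀ x) + w ‖x‖ * (u₀ x * v₀ x)) ∂μ)) := by
  have t1 := tendsto_integral_inner hg hf hg₀ hf₀ hgl hfl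
  have t2 := tendsto_integral_inner (fun k => memLp_mul_norm w (hu k)) hv (memLp_mul_norm w hu₀) hv₀
    (tendsto_eLpNorm_mul (ae_of_all _ fun x => w.norm_coe_le_norm ‖x‖) hul) hvl
  have key : ∀ {a b : Eu (n + 1) → ℝ} {c d : Eu (n + 1) → Eu (n + 1)}, MemLp a 2 μ → MemLp b 2 μ →
      MemLp c 2 μ → MemLp d 2 μ → ∫ x, (inner ℝ (c x) (d x) + w ‖x‖ * (a x * b x)) ∂μ =
        (∫ x, inner ℝ (c x) (d x) ∂μ) + ∫ x, inner ℝ (w ‖x‖ * a x) (b x) ∂μ := by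
    intro a b c d ha hb hc hd
    rw [← integral_add (integrable_inner_of_memLp hc hd) (integrable_inner_of_memLp (memLp_mul_norm w ha) hb)]
    refine integral_congr_ae (ae_of_all _ fun x => ?_)
    simp
    ring
  rw [key hu₀ hv₀ hg₀ hf₀]
  simpa only [key (hu _) (hv _) (hg _) (hf _)] using t1.add t2

theorem weak_ballSol {v : Eu (n + 1) → ℝ}
    {g : Eu (n + 1) → Eu (n + 1)} (hv : MemH10 (Metric.ball 0 ρ) v g) :
    ∫ x in Metric.ball 0 ρ, (inner ℝ (g x) (ballGrad n ρ w x) +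
      w ‖x‖ * (ballSol n ρ w x * v x)) = 0 := by
  obtain ⟨⟨hv2, hg2, -⟩, φ, hφ, h1, h2⟩ := hv
  have hU : MemLp (ballSol n ρ w) 2 (volume.restrict (Metric.ball 0 ρ)) :=
    memLp_ball_of_continuous (continuous_ballSol n ρ w)
  have hX : MemLp (ballGrad n ρ w) 2 (volume.restrict (Metric.ball 0 ρ)) :=
    memLp_ball_of_continuous (continuous_ballGrad n ρ w)
  have t := integral_form_tendsto w (fun _ => hU) (fun k => (hφ k).memLp _) (fun _ => hX)
    (fun k => (hφ k).memLp_gradient _) hU hv2 hX hg2 (tendsto_eLpNorm_const _) h1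
    (tendsto_eLpNorm_const _) h2
  have e : ∀ k, ∫ x in Metric.ball 0 ρ, (inner ℝ (gradient (φ k) x) (ballGrad n ρ w x) +
      w ‖x‖ * (ballSol n ρ w x * φ k x)) = 0 := fun k =>
    setIntegral_ballGrad_eq_zero n w (hφ k).hasGradientAt (hφ k).continuous_gradient (hφ k).2.1
      (hφ k).2.2
  simp only [e] at t
  exact (tendsto_nhds_unique tendsto_const_nhds t).symm

/-- Barta's inequality. -/
theorem barta (hpos : ∀ r ∈ Ico 0 ρ, 0 < radialSol n ρ w r) {v : Eu (n + 1) → ℝ}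
    {g : Eu (n + 1) → Eu (n + 1)} (hv : MemH10 (Metric.ball 0 ρ) v g) :
    0 ≤ ∫ x in Metric.ball 0 ρ, (inner ℝ (g x) (g x) + w ‖x‖ * (v x * v x)) := by
  obtain ⟨⟨hv2, hg2, -⟩, φ, hφ, h1, h2⟩ := hv
  have t := integral_form_tendsto w (fun k => (hφ k).memLp _) (fun k => (hφ k).memLp _)
    (fun k => (hφ k).memLp_gradient _) (fun k => (hφ k).memLp_gradient _) hv2 hv2 hg2 hg2 h1 h1 h2 h2
  exact ge_of_tendsto' t fun k => barta_test n hpos (hφ k)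

/-- Splitting off E ∫ u v isolates the form with potential σV - E, which vanishes when u is the
ground state and is nonnegative on the diagonal by Barta. -/
theorem integral_schrodinger_eq {s σ E : ℝ} {V : ℝ →ᵇ ℝ} (hV : ∀ r ∈ Icc 0 ρ, V r = r ^ (2 * s))
    {u v : Eu (n + 1) → ℝ} {f g : Eu (n + 1) → Eu (n + 1)}
    (hu : MemLp u 2 (volume.restrict (Metric.ball 0 ρ)))
    (hv : MemLp v 2 (volume.restrict (Metric.ball 0 ρ)))
    (hf : MemLp f 2 (volume.restrict (Metric.ball 0 ρ)))
    (hg : MemLp g 2 (volume.restrict (Metric.ball 0 ρ))) :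
    ∫ x in Metric.ball 0 ρ, (inner ℝ (f x) (g x) + σ * ‖x‖ ^ (2 * s) * u x * v x) =
      (∫ x in Metric.ball 0 ρ, (inner ℝ (g x) (f x) + pot V σ E ‖x‖ * (u x * v x))) +
        E * ∫ x in Metric.ball 0 ρ, u x * v x := by
  have i1 : Integrable (fun x => u x * v x) (volume.restrict (Metric.ball 0 ρ)) :=
    hu.integrable_mul hv
  have i2 : Integrable (fun x => inner ℝ (g x) (f x) + pot V σ E ‖x‖ * (u x * v x))
      (volume.restrict (Metric.ball 0 ρ)) := by
    have h := (integrable_inner_of_memLp hg hf).add ((memLp_mul_norm (pot V σ E) hu).integrable_mul hv)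
    refine h.congr (ae_of_all _ fun x => ?_)
    simp [mul_assoc]
  rw [← integral_const_mul, ← integral_add i2 (i1.const_mul E)]
  refine setIntegral_congr_fun measurableSet_ball fun x hx => ?_
  rw [pot_apply, hV ‖x‖ ⟨norm_nonneg x, (mem_ball_zero_iff.1 hx).le⟩, real_inner_comm]
  ring

/-- An eigenfunction for lam, tested with itself, has form (lam - E) ∫ u², and Barta's inequality
makes this nonnegative. -/
theorem IsGround.isLeast {s σ E : ℝ} {V : ℝ →ᵇ ℝ} (hρ : 0 < ρ)
    (hV : ∀ r ∈ Icc 0 ρ, V r = r ^ (2 * s)) (h : IsGround n ρ V σ E) :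
    IsLeast {lam : ℝ | IsSchrodingerEigenvalue s σ (Metric.ball (0 : Eu (n + 1)) ρ) lam} E := by
  have hU := memH10_ballSol n hρ h.zero
  refine ⟨⟨ballSol n ρ (pot V σ E), ballGrad n ρ (pot V σ E), hU, fun hzero => ?_,
    fun v gv hv => ?_⟩, fun lam hlam => ?_⟩
  · have h1 : ∀ᵐ x ∂(volume.restrict (Metric.ball (0 : Eu (n + 1)) ρ)), False := by
      filter_upwards [hzero, ae_restrict_mem measurableSet_ball] with x hx hxb
      rw [ballSol_eq n _ hxb] at hx
      exact (h.pos _ ⟨norm_nonneg x, mem_ball_zero_iff.1 hxb⟩).ne' hx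
    rw [eventually_false_iff_eq_bot, ae_eq_bot, Measure.restrict_eq_zero] at h1
    exact (Metric.measure_ball_pos volume (0 : Eu (n + 1)) hρ).ne' h1
  · rw [integral_schrodinger_eq (E := E) hV hU.1.1 hv.1.1 hU.1.2.1 hv.1.2.1,
      weak_ballSol hv, zero_add]
  · obtain ⟨u, gu, hu, hne, heq⟩ := hlam
    have h1 := heq u gu hu
    rw [integral_schrodinger_eq (E := E) hV hu.1.1 hu.1.1 hu.1.2.1 hu.1.2.1] at h1
    have h2 := barta h.pos hu
    have h3 : 0 < ∫ x in Metric.ball 0 ρ, u x * u x := by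
      refine lt_of_le_of_ne (integral_nonneg fun x => mul_self_nonneg _) fun hcon => hne ?_
      have h4 := (integral_eq_zero_iff_of_nonneg (fun x => mul_self_nonneg (u x))
        (hu.1.1.integrable_mul hu.1.1)).1 hcon.symm
      filter_upwards [h4] with x hx
      exact mul_self_eq_zero.1 hx
    refine le_of_mul_le_mul_right ?_ h3
    linarith

end Eigenvalue

/-! ### The power potential and the conclusion -/

/-- The function `r ↦ r^{2s}` on `[0, ρ]`, extended to `ℝ` by constants. -/
noncomputable def powPotential {s : ℝ} (hs : 0 < s) (ρ : ℝ) : ℝ →ᵇ ℝ :=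
  BoundedContinuousFunction.ofNormedAddCommGroup (fun r => clamp ρ r ^ (2 * s))
    ((continuous_clamp ρ).rpow_const fun _ => Or.inr (by positivity)) (|ρ| ^ (2 * s)) fun r => by
      rw [Real.norm_of_nonneg (Real.rpow_nonneg (clamp_nonneg ρ r) _)]
      exact Real.rpow_le_rpow (clamp_nonneg ρ r) (clamp_le_abs ρ r) (by positivity)

theorem powPotential_apply {s : ℝ} (hs : 0 < s) {ρ r : ℝ} (hr : r ∈ Icc 0 ρ) :
    powPotential hs ρ r = r ^ (2 * s) := by
  change clamp ρ r ^ (2 * s) = _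
  rw [clamp_of_mem hr]

end Grushin

open Grushin in
theorem mainTheorem3 (d₁ d₂ : ℕ) (hd₁ : 1 ≤ d₁) (hd₂ : 1 ≤ d₂) (s : ℝ) (hs : 0 < s) :
    (∀ σ : ℝ, 0 < σ →
      IsLeast {lam : ℝ | Grushin.IsSchrodingerEigenvalue s σ (Grushin.unitVolumeBall d₁) lam}
        (Grushin.E1 s σ (Grushin.unitVolumeBall d₁))) ∧
    ContDiffOn ℝ ∞ (Grushin.F d₁ d₂ s) (Ioi 0) ∧
    Tendsto (Grushin.F d₁ d₂ s) (𝓝[>] 0) atTop ∧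
    Tendsto (Grushin.F d₁ d₂ s) atTop atTop ∧
    (∀ σ : ℝ, 0 < σ → deriv (Grushin.F d₁ d₂ s) σ = 0 →
      0 < deriv (deriv (Grushin.F d₁ d₂ s)) σ) ∧
    (∃! σ : ℝ, 0 < σ ∧ IsMinOn (Grushin.F d₁ d₂ s) (Ioi 0) σ) := by
  obtain ⟨n, rfl⟩ : ∃ n, d₁ = n + 1 := ⟨d₁ - 1, by omega⟩
  set ρ : ℝ := (volume (Metric.ball (0 : Eu (n + 1)) 1)).toReal ^ (-(1 / ((n + 1 : ℕ) : ℝ))) with hρd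
  have hball : unitVolumeBall (n + 1) = Metric.ball 0 ρ := rfl
  have hρ : 0 < ρ := Real.rpow_pos_of_pos (ENNReal.toReal_pos
    (Metric.measure_ball_pos volume _ one_pos).ne' measure_ball_lt_top.ne) _
  set V := powPotential hs ρ
  have hV : ∀ r ∈ Icc 0 ρ, V r = r ^ (2 * s) := fun r hr => powPotential_apply hs hr
  have hex : ∀ σ : ℝ, 0 ≤ σ → ∃ E, IsGround n ρ V σ E := fun σ hσ =>
    exists_isGround n hρ (fun r hr => by rw [hV r hr]; exact Real.rpow_nonneg hr.1 _) hσ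
  choose! e he' using hex
  have he : ∀ σ, 0 < σ → IsGround n ρ V σ (e σ) := fun σ hσ => he' σ hσ.le
  have hleast : ∀ σ, 0 < σ → IsLeast
      {lam : ℝ | IsSchrodingerEigenvalue s σ (unitVolumeBall (n + 1)) lam} (e σ) := fun σ hσ =>
    (he σ hσ).isLeast hρ hV
  have hE1 : ∀ σ, 0 < σ → E1 s σ (unitVolumeBall (n + 1)) = e σ := fun σ hσ =>
    (hleast σ hσ).csInf_eq
  have hd₂' : (0 : ℝ) < d₂ := by exact_mod_cast hd₂
  set α : ℝ := (d₂ : ℝ) / (((n + 1 : ℕ) : ℝ) + (1 + s) * d₂) with hα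
  have hα0 : 0 < α := by positivity
  -- Equivalent to d₁ > 0; this is what lets the growth σ^{1/(1+s)} of the energy beat σ^{-α} at
  -- infinity.
  have hα1 : α < 1 / (1 + s) := by
    rw [hα, div_lt_div_iff₀ (by positivity) (by positivity)]
    have : (0 : ℝ) < ((n + 1 : ℕ) : ℝ) := by positivity
    linarith
  have hF : ∀ σ, 0 < σ → F (n + 1) d₂ s σ = σ ^ (-α) * e σ := fun σ hσ => by
    rw [F, hE1 σ hσ]
  have hsmooth := contDiffOn_ground hρ he
  have hpos : ∀ σ, 0 < σ → 0 < e σ := fun σ hσ => (he σ hσ).energy_pos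
  have hlog := fun σ (hσ : 0 < σ) => deriv_log_ground_pos hρ hs hV he hσ
  have hc : (0 : ℝ) < 4 ^ (-s) := Real.rpow_pos_of_pos (by norm_num) _
  have h0 : Tendsto (F (n + 1) d₂ s) (𝓝[>] 0) atTop :=
    tendsto_rpow_mul_zero hα0 (div_pos hc (by positivity))
      (fun σ hσ => (he σ hσ).const_le_energy hρ hs hV hσ) hF
  have h1 : Tendsto (F (n + 1) d₂ s) atTop atTop :=
    tendsto_rpow_mul_atTop hα1 (div_pos hc (by positivity))
      (fun σ hσ => (he σ hσ).rpow_le_energy hρ hs hV hσ) hF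
  exact ⟨fun σ hσ => by rw [hE1 σ hσ]; exact hleast σ hσ, contDiffOn_rpow_mul hsmooth hF, h0, h1,
    fun σ hσ hd => deriv_deriv_pos_of_deriv_eq_zero hsmooth hpos hlog hF hσ hd,
    existsUnique_isMinOn_rpow_mul hsmooth hpos hlog hF h0 h1⟩
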